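/- **Lemma 4.13 (Weierstrass extensions).** Let $\mathcal A$ be a differential field of characteristic $0$ which is a saturated model of $DCF_0$ (saturated differentially closed field), and let $K\subseteq L\subseteq \mathfrak U\subseteq\mathcal A$ be differential subfields with $|K|<|\mathcal A|$. For a differential field $F$ let $C_F$ denote its field of constants, and let $\langle\,\cdot\,\rangle$ denote the differential subfield of $\mathcal A$ generated by given elements or subfields. Assume that $L$ is a strongly normal extension of $K$: $L$ is finitely generated over $K$ as a differential field, and every differential field embedding $\tau:L\to\mathcal A$ over $K$ is the identity on $C_L$ and satisfies $\langle L,C_{\mathcal A}\rangle=\langle\tau(L),C_{\mathcal A}\rangle$. Let $k\in K\setminus\{0\}$ and $g_2,g_3\in C_K$ with $g_2^3+27g_3^2\neq 0$, and suppose that $L=K\langle a\rangle$ where $$(a')^2=k^2\,(4a^3+g_2a-g_3).$$ Let $\mathcal E$ be the elliptic curve $y^2=4x^3+g_2x-g_3$ (including its point at infinity), with group law $\oplus$; for a field $F$ with $C_K\subseteq F\subseteq \mathcal A$ let $\mathcal E(F)$ be its group of $F$-points. Let $gal(L/K)$ be the group of differential field automorphisms of $L$ fixing $K$ pointwise, and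 $Gal_{\mathfrak U}(L/K)$ the group of differential field automorphisms of $\langle L,C_{\mathfrak U}\rangle$ fixing $\langle K,C_{\mathfrak U}\rangle$ pointwise. Then the map $$\sigma\longmapsto \Big(\sigma(a),\frac{\sigma(a)'}{k}\Big)\ominus\Big(a,\frac{a'}{k}\Big)$$ 1. is an injective group morphism $gal(L/K)\to\mathcal E(C_K)$, whose image is a subgroup of $\mathcal E(C_K)$ definable in the field $C_K$ (by a formula of the language of rings with parameters in $C_K$); 2. is an injective group morphism $Gal_{\mathfrak U}(L/K)\to\mathcal E(C_{\mathfrak U})$, whose image is a subgroup of $\mathcal E(C_{\mathfrak U})$ definable in the field $C_{\mathfrak U}$ (by a formula of the language of rings with parameters in $C_K$). Here a set of points is called definable if the set of affine coordinates $(x,y)$ of its points other than the point at infinity is definable. -/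

import Mathlib

open scoped Differential Cardinal

noncomputable section

universe u

/-! ### Differential subfields, constants, differential automorphisms -/

/-- A differential subfield of a differential field: a subfield closed under the derivation. -/
structure DiffSubfield (A : Type u) [Field A] [Differential A] extends Subfield A where
  deriv_mem' : ∀ x ∈ carrier, x′ ∈ carrier

namespace DiffSubfield

variable {A : Type u} [Field A] [Differential A]

instance : SetLike (DiffSubfield A) A where
  coe F := F.carrier
  coe_injective := by
    rintro ⟨F, hF⟩ ⟨G, hG⟩ h
    have : F = G := SetLike.coe_injective h
    subst this
    rfl

instance : PartialOrder (DiffSubfield A) := PartialOrder.ofSetLike (DiffSubfield A) A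

instance : SubfieldClass (DiffSubfield A) A where
  add_mem := fun {F} _ _ hx hy => F.add_mem' hx hy
  mul_mem := fun {F} _ _ hx hy => F.mul_mem' hx hy
  neg_mem := fun {F} _ hx => F.neg_mem' hx
  zero_mem := fun F => F.zero_mem'
  one_mem := fun F => F.one_mem'
  inv_mem := fun {F} x hx => F.inv_mem' x hx

theorem deriv_mem (F : DiffSubfield A) {x : A} (hx : x ∈ F) : x′ ∈ F := F.deriv_mem' x hx

/-- The derivation of `A` restricted to a differential subfield. -/
instance (F : DiffSubfield A) : Differential F where
  deriv :=
    Derivation.mk'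
      { toFun := fun x => ⟨(x : A)′, F.deriv_mem x.2⟩
        map_add' := fun x y => Subtype.ext (by simp)
        map_smul' := fun n x => Subtype.ext (by simp) }
      (fun x y => Subtype.ext (by simp))

@[simp]
theorem coe_deriv (F : DiffSubfield A) (x : F) : ((x′ : F) : A) = (x : A)′ := rfl

/-- The differential subfield `⟨s⟩` of `A` generated by a set `s`: the intersection of all the
differential subfields that contain `s`. -/
def gen (s : Set A) : DiffSubfield A where
  toSubfield := sInf {F : Subfield A | s ⊆ F ∧ ∀ x ∈ F, x′ ∈ F}
  deriv_mem' := by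
    intro x hx
    have hx' : x ∈ sInf {F : Subfield A | s ⊆ F ∧ ∀ x ∈ F, x′ ∈ F} := hx
    change x′ ∈ sInf {F : Subfield A | s ⊆ F ∧ ∀ x ∈ F, x′ ∈ F}
    rw [Subfield.mem_sInf] at hx' ⊢
    exact fun F hF => hF.2 x (hx' F hF)

theorem mem_gen {s : Set A} {x : A} :
    x ∈ gen s ↔ ∀ F : Subfield A, s ⊆ F ∧ (∀ y ∈ F, y′ ∈ F) → x ∈ F := by
  change x ∈ sInf {F : Subfield A | s ⊆ F ∧ ∀ x ∈ F, x′ ∈ F} ↔ _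
  rw [Subfield.mem_sInf]
  rfl

theorem subset_gen (s : Set A) : s ⊆ gen s := fun _ hx => mem_gen.2 fun _ hF => hF.1 hx

/-- The subfield of constants `C_F` of a differential subfield `F`. -/
def constants (F : DiffSubfield A) : Subfield A where
  carrier := {x | x ∈ F ∧ x′ = 0}
  add_mem' := fun hx hy => ⟨add_mem hx.1 hy.1, by simp [hx.2, hy.2]⟩
  mul_mem' := fun hx hy => ⟨mul_mem hx.1 hy.1, by simp [hx.2, hy.2]⟩
  neg_mem' := fun hx => ⟨neg_mem hx.1, by simp [hx.2]⟩
  zero_mem' := ⟨zero_mem F, by simp⟩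
  one_mem' := ⟨one_mem F, by simp⟩
  inv_mem' := fun x hx => ⟨inv_mem hx.1, by
    by_cases h : x = 0
    · simp [h]
    · have h1 : (x * x⁻¹)′ = 0 := by rw [mul_inv_cancel₀ h]; simp
      rw [Derivation.leibniz, hx.2, smul_zero, add_zero, smul_eq_mul] at h1
      exact (mul_eq_zero.1 h1).resolve_left h⟩

theorem constants_mono {F G : DiffSubfield A} (h : F ≤ G) : constants F ≤ constants G :=
  fun _ hx => ⟨h hx.1, hx.2⟩

/-- The differential subfield `⟨F, C_U⟩` of `A`. -/
def adjoinConstants (F U : DiffSubfield A) : DiffSubfield A :=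
  gen ((F : Set A) ∪ (constants U : Set A))

theorem le_adjoinConstants (F U : DiffSubfield A) : F ≤ adjoinConstants F U :=
  fun _ hx => subset_gen _ (Or.inl hx)

/-- The group (under composition) of the differential field automorphisms of `M` that fix every
element of `M` lying in `F`. -/
def diffAut (F M : DiffSubfield A) : Subgroup (M ≃+* M) where
  carrier := {σ | (∀ x : M, σ (x′) = (σ x)′) ∧ ∀ x : M, (x : A) ∈ F → σ x = x}
  mul_mem' := by
    rintro σ τ ⟨h1, h2⟩ ⟨h3, h4⟩
    refine ⟨fun x => ?_, fun x hx => ?_⟩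
    · simp only [RingAut.mul_apply, h3, h1]
    · simp only [RingAut.mul_apply, h4 x hx, h2 x hx]
  one_mem' := ⟨fun _ => rfl, fun _ _ => rfl⟩
  inv_mem' := by
    rintro σ ⟨h1, h2⟩
    refine ⟨fun x => ?_, fun x hx => ?_⟩
    · change σ.symm (x′) = ((σ.symm x)′ : M)
      rw [RingEquiv.symm_apply_eq, h1, RingEquiv.apply_symm_apply]
    · change σ.symm x = x
      rw [RingEquiv.symm_apply_eq, h2 x hx]

/-- `gal(L/K)`: the group of differential field automorphisms of `L` fixing `K`. -/
abbrev gal (K L : DiffSubfield A) : Subgroup (L ≃+* L) := diffAut K L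

/-- `Gal_U(L/K)`: the group of differential field automorphisms of `⟨L, C_U⟩`
fixing `⟨K, C_U⟩`. -/
abbrev galOver (U K L : DiffSubfield A) :
    Subgroup (adjoinConstants L U ≃+* adjoinConstants L U) :=
  diffAut (adjoinConstants K U) (adjoinConstants L U)

/-- `L` is a (finitely generated) strongly normal extension of `K`, inside the universal
differential field `A`: `L` is finitely generated over `K` as a differential field and every
differential field embedding `τ : L → A` over `K` is strong, i.e. is the identity on `C_L` and
satisfies `⟨L, C_A⟩ = ⟨τ(L), C_A⟩`. -/
structure IsStronglyNormal (K L : DiffSubfield A) : Prop where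
  le : K ≤ L
  fg : ∃ s : Finset A, L = gen ((K : Set A) ∪ s)
  strong : ∀ τ : L →+* A, (∀ x : L, τ (x′) = (τ x)′) → (∀ x : L, (x : A) ∈ K → τ x = x) →
    (∀ x : L, (x : A) ∈ constants L → τ x = x) ∧
      gen ((L : Set A) ∪ {c : A | c′ = 0}) = gen (Set.range τ ∪ {c : A | c′ = 0})

end DiffSubfield

/-! ### Saturated differentially closed fields -/

/-- A differential field of characteristic `0` is differentially closed (Blum's axioms): for all
differential polynomials `f`, `g` in one indeterminate, with `g ≠ 0` and `f` of order `n` greater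
than the order of `g`, there is `a` with `f(a) = 0` and `g(a) ≠ 0`. A differential polynomial is a
polynomial in the variables `X^{(i)}`, `i ∈ ℕ`; its order is the largest `i` such that `X^{(i)}`
occurs in it, and nonzero elements of the field have order less than `0`. -/
def IsDifferentiallyClosed (A : Type u) [Field A] [Differential A] : Prop :=
  ∀ (f g : MvPolynomial ℕ A) (n : ℕ), n ∈ f.vars → (∀ i ∈ f.vars, i ≤ n) →
    g ≠ 0 → (∀ i ∈ g.vars, i < n) →
    ∃ a : A, MvPolynomial.eval (fun i => (fun x : A => x′)^[i] a) f = 0 ∧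
      MvPolynomial.eval (fun i => (fun x : A => x′)^[i] a) g ≠ 0

/-- The function symbols of the language of differential rings. -/
inductive DiffRingFunc : ℕ → Type
  | zero : DiffRingFunc 0
  | one : DiffRingFunc 0
  | neg : DiffRingFunc 1
  | deriv : DiffRingFunc 1
  | add : DiffRingFunc 2
  | mul : DiffRingFunc 2

/-- The first-order language of differential rings. -/
def diffRingLanguage : FirstOrder.Language.{0, 0} := ⟨DiffRingFunc, fun _ => Empty⟩

/-- A differential ring as a structure for the language of differential rings. -/
instance diffRingStructure (A : Type u) [CommRing A] [Differential A] :
    diffRingLanguage.Structure A where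
  funMap := fun {n} f =>
    match n, f with
    | _, DiffRingFunc.zero => fun _ => 0
    | _, DiffRingFunc.one => fun _ => 1
    | _, DiffRingFunc.neg => fun x => -x 0
    | _, DiffRingFunc.deriv => fun x => (x 0)′
    | _, DiffRingFunc.add => fun x => x 0 + x 1
    | _, DiffRingFunc.mul => fun x => x 0 * x 1
  RelMap := fun r => r.elim

open FirstOrder in
/-- A structure `M` is saturated: for every `B ⊆ M` with `|B| < |M|`, every set of formulas in one
variable with parameters in `B` that is finitely satisfiable in `M` is realised in `M`. -/
def IsSaturated (Λ : FirstOrder.Language.{0, 0}) (M : Type u) [Λ.Structure M] : Prop :=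
  ∀ B : Set M, #B < #M → ∀ p : Set (Λ[[B]].Formula Unit),
    (∀ q : Finset (Λ[[B]].Formula Unit), (q : Set (Λ[[B]].Formula Unit)) ⊆ p →
      ∃ x : M, ∀ φ ∈ q, φ.Realize (fun _ => x)) →
    ∃ x : M, ∀ φ ∈ p, φ.Realize (fun _ => x)

/-! ### The elliptic curve `y² = 4x³ + g₂x - g₃` -/

namespace Weierstrass

variable {A : Type u} [Field A]

/-- The curve `y² = 4x³ + g₂x - g₃`, in the form `(y/2)² = x³ + (g₂/4)x - g₃/4`, that is, in the
coordinates `(x, y/2)`. -/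
def curve (g2 g3 : A) : WeierstrassCurve.Affine A := ⟨0, 0, 0, g2 / 4, -g3 / 4⟩

/-- The `A`-points of the projective curve, with their group law. -/
abbrev Pt (g2 g3 : A) : Type u := (curve g2 g3).Point

/-- The point `P` is the affine point `(x, y)` of the curve `y² = 4x³ + g₂x - g₃`. -/
def HasCoords {g2 g3 : A} (P : Pt g2 g3) (x y : A) : Prop :=
  ∃ h : (curve g2 g3).Nonsingular x (y / 2), P = WeierstrassCurve.Affine.Point.some x (y / 2) h

theorem exists_hasCoords_iff [CharZero A] {g2 g3 : A} (hΔ : g2 ^ 3 + 27 * g3 ^ 2 ≠ 0) (x y : A) :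
    (∃ P : Pt g2 g3, HasCoords P x y) ↔ y ^ 2 = 4 * x ^ 3 + g2 * x - g3 := by
  have key : (curve g2 g3).Equation x (y / 2) ↔ y ^ 2 = 4 * x ^ 3 + g2 * x - g3 := by
    rw [WeierstrassCurve.Affine.equation_iff]
    simp only [curve]
    constructor
    · intro h
      linear_combination 4 * h
    · intro h
      linear_combination h / 4
  rw [← key]
  constructor
  · rintro ⟨P, h, -⟩
    exact h.1
  · intro h
    have hd : (curve g2 g3).Δ ≠ 0 := by
      have : (curve g2 g3).Δ = -(g2 ^ 3 + 27 * g3 ^ 2) := by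
        simp only [WeierstrassCurve.Δ, WeierstrassCurve.b₂, WeierstrassCurve.b₄,
          WeierstrassCurve.b₆, WeierstrassCurve.b₈, curve]
        ring
      rw [this]
      exact neg_ne_zero.2 hΔ
    exact ⟨_, (WeierstrassCurve.Affine.equation_iff_nonsingular_of_Δ_ne_zero hd).1 h, rfl⟩

open Classical in
/-- For a subfield `F` of `A` that contains `g₂` and `g₃`, the subgroup of the `F`-points: the
point at infinity and the affine points with both coordinates in `F`. -/
def rationalPoints [CharZero A] {g2 g3 : A} (F : Subfield A) (h2 : g2 ∈ F) (h3 : g3 ∈ F) :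
    AddSubgroup (Pt g2 g3) where
  carrier := {P | P = 0 ∨ ∃ x ∈ F, ∃ y ∈ F, HasCoords P x y}
  zero_mem' := Or.inl rfl
  neg_mem' := by
    rintro P (rfl | ⟨x, hx, y, hy, h, rfl⟩)
    · exact Or.inl neg_zero
    · refine Or.inr ⟨x, hx, -y, neg_mem hy, ?_⟩
      have e : (curve g2 g3).negY x (y / 2) = -y / 2 := by
        simp only [WeierstrassCurve.Affine.negY, curve]
        ring
      rw [WeierstrassCurve.Affine.Point.neg_some]
      have h' := (WeierstrassCurve.Affine.nonsingular_neg x (y / 2)).2 h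
      refine ⟨e ▸ h', ?_⟩
      congr 1
  add_mem' := by
    rintro P Q (rfl | ⟨x, hx, y, hy, h, rfl⟩) (rfl | ⟨z, hz, w, hw, h', rfl⟩)
    · exact Or.inl (add_zero _)
    · exact Or.inr ⟨z, hz, w, hw, h', zero_add _⟩
    · exact Or.inr ⟨x, hx, y, hy, h, add_zero _⟩
    · by_cases hxy : x = z ∧ y / 2 = (curve g2 g3).negY z (w / 2)
      · exact Or.inl (WeierstrassCurve.Affine.Point.add_of_Y_eq hxy.1 hxy.2)
      · have t2 : (2 : A) ∈ F := ofNat_mem F 2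
        have t3 : (3 : A) ∈ F := ofNat_mem F 3
        have t4 : (4 : A) ∈ F := ofNat_mem F 4
        have hy2 : y / 2 ∈ F := div_mem hy t2
        have hw2 : w / 2 ∈ F := div_mem hw t2
        have hs : (curve g2 g3).slope x z (y / 2) (w / 2) ∈ F := by
          unfold WeierstrassCurve.Affine.slope
          split_ifs
          · exact zero_mem F
          · simp only [WeierstrassCurve.Affine.negY, curve, mul_zero, zero_mul, sub_zero,
              add_zero]
            exact div_mem (add_mem (mul_mem t3 (pow_mem hx 2)) (div_mem h2 t4))
              (sub_mem hy2 (neg_mem hy2))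
          · exact div_mem (sub_mem hy2 hw2) (sub_mem hx hz)
        have hX : (curve g2 g3).addX x z ((curve g2 g3).slope x z (y / 2) (w / 2)) ∈ F := by
          simp only [WeierstrassCurve.Affine.addX, curve, zero_mul, sub_zero, add_zero]
          exact sub_mem (sub_mem (pow_mem hs 2) hx) hz
        have hY : (curve g2 g3).addY x z (y / 2) ((curve g2 g3).slope x z (y / 2) (w / 2)) ∈ F := by
          simp only [WeierstrassCurve.Affine.addY, WeierstrassCurve.Affine.negY,
            WeierstrassCurve.Affine.negAddY]
          refine sub_mem (sub_mem (neg_mem (add_mem (mul_mem hs (sub_mem hX hx)) hy2)) ?_)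
            (zero_mem F)
          exact mul_mem (zero_mem F) hX
        rw [WeierstrassCurve.Affine.Point.add_some hxy]
        refine Or.inr ⟨_, hX, _, mul_mem hY t2, ?_⟩
        have e := mul_div_cancel_right₀
          ((curve g2 g3).addY x z (y / 2) ((curve g2 g3).slope x z (y / 2) (w / 2)))
          (two_ne_zero (α := A))
        unfold HasCoords
        simp only [e]
        exact ⟨WeierstrassCurve.Affine.nonsingular_add h h' hxy, trivial⟩

/-- A set `S` of points of the curve is definable in the field `F` with parameters in `B`: the set
of the affine coordinates in `F × F` of its elements is definable by a first-order formula in the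
language of rings with parameters in `B`. -/
def DefinableIn {g2 g3 : A} (F : Subfield A) (B : Set F) (S : Set (Pt g2 g3)) : Prop :=
  letI := FirstOrder.Ring.compatibleRingOfRing F
  B.Definable FirstOrder.Language.ring {v : Fin 2 → F | ∃ P ∈ S, HasCoords P (v 0 : A) (v 1 : A)}

open Classical in
/-- The point `R` is `(σ(a), σ(a)′/k) ⊖ (a, a′/k)`. -/
def IsShift {g2 g3 : A} [Differential A] (k : A) {M : DiffSubfield A} (a : M) (σ : M ≃+* M)
    (R : Pt g2 g3) : Prop :=
  ∃ P Q : Pt g2 g3, HasCoords P (σ a : A) ((σ a : A)′ / k) ∧ HasCoords Q (a : A) ((a : A)′ / k) ∧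
    R = P - Q

end Weierstrass

end

open DiffSubfield Weierstrass

/-! Let Q = (a, a′/k), a point of the curve over L. The invariant differential dx/y gives points a
logarithmic derivative x′/y. Since dx/y is translation invariant and g₂, g₃ are constants, this is
additive for the group law (`HasLogDeriv.add`). If a is not constant, Q and σ(Q) both have
logarithmic derivative k, so R_σ = σ(Q) ⊖ Q has logarithmic derivative 0, that is, constant
coordinates. Constants of L lie in K (`IsStronglyNormal.mem_of_deriv_eq_zero`), and constants of ⟨L,
C_U⟩ lie in C_U because that field sits inside U. So R_σ is fixed by every automorphism and στ(Q) =
σ(Q ⊕ R_τ) = Q ⊕ R_σ ⊕ R_τ: the map is a morphism. It is injective because a generates the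
extension. If a is constant, it lies in the base field and everything is trivial.

For the image: a constant point R belongs to it iff Q ⊕ R satisfies every polynomial relation over K
that Q satisfies. Necessity follows by applying σ. Conversely, Q = (Q ⊕ R) ⊖ R is recovered from Q ⊕
R, so no further relation appears and Q ↦ Q ⊕ R defines a field automorphism; it respects the
derivation because Q ⊕ R has logarithmic derivative k + 0 (`exists_diffAut`). By Hilbert's basis
theorem finitely many relations suffice, and the addition formulas turn each of them into a
polynomial condition over L on the coordinates of R. Finally, L is linearly disjoint over C_K from
any larger field of constants (`linearIndependent_of_constants`). This brings the coefficients down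
to C_K (`exists_finset_constants`) and carries relations over K to relations over ⟨K, C_U⟩
(`aeval_eq_zero_of_adjoin_constants`).

For the constants of L: a constant c transcendental over K could be moved to c + 1 by a differential
embedding of L, against strong normality. If c is algebraic over K, then either a is transcendental
and K is relatively algebraically closed in K(a, y), or a is algebraic and strong normality makes c
its own only conjugate. -/

/-! ### Points of the curve: functoriality, coordinates, explicit addition. -/

namespace WeierstrassCurve.Affine.Point

/-- The homomorphism on points induced by a homomorphism of fields. -/
noncomputable def mapHom {F K : Type*} [Field F] [Field K] [DecidableEq F] [DecidableEq K] (W : Affine F) (f : F →+* K) :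
    W.Point →+ WeierstrassCurve.Affine.Point (W.map f) where
  toFun P := match P with
    | 0 => 0
    | some _ _ h => some _ _ <| (W.map_nonsingular f.injective ..).mpr h
  map_zero' := rfl
  map_add' := by
    rintro (_ | ⟨x₁, y₁, h₁⟩) (_ | ⟨x₂, y₂, h₂⟩)
    any_goals rfl
    by_cases hxy : x₁ = x₂ ∧ y₁ = W.negY x₂ y₂
    · rw [add_of_Y_eq hxy.left hxy.right,
        add_of_Y_eq (congr_arg _ hxy.left) <| by rw [hxy.right]; exact (map_negY ..).symm]
    · simpa only [add_some hxy, ← map_addX, ← map_addY, ← map_slope] using!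
        (add_some fun h ↦ hxy ⟨f.injective h.1, f.injective ((W.map_negY f ..) ▸ h).2⟩).symm

theorem exists_mapHom {F K : Type*} [Field F] [Field K] [DecidableEq F] [DecidableEq K]
    (W : Affine F) (W' : Affine K) (f : F →+* K) (e : W.map f = W') : ∃ φ : W.Point →+ W'.Point, ∀ x y (h : W.Nonsingular x y),
      ∃ h', φ (some x y h) = some (f x) (f y) h' := by
  subst e
  exact ⟨mapHom W f, fun x y h => ⟨_, rfl⟩⟩

end WeierstrassCurve.Affine.Point

namespace Weierstrass

open WeierstrassCurve.Affine

theorem map_curve {F K : Type*} [Field F] [Field K] (f : F →+* K) (g2 g3 : F) :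
    WeierstrassCurve.map (curve g2 g3) f = curve (f g2) (f g3) := by
  ext <;> simp [curve, map_ofNat f 4]

/-- The homomorphism on points of `y² = 4x³ + g₂x - g₃` induced by a homomorphism of fields. -/
theorem exists_mapPt {F K : Type*} [Field F] [Field K] [DecidableEq F] [DecidableEq K] (f : F →+* K) {g2 g3 : F} {h2 h3 : K}
    (e2 : f g2 = h2) (e3 : f g3 = h3) :
    ∃ φ : Pt g2 g3 →+ Pt h2 h3, ∀ P x y, HasCoords P x y → HasCoords (φ P) (f x) (f y) := by
  obtain ⟨φ, hφ⟩ := Point.exists_mapHom (curve g2 g3) (curve h2 h3) f 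
    ((map_curve f g2 g3).trans (by rw [e2, e3]))
  refine ⟨φ, ?_⟩
  rintro _ x y ⟨h, rfl⟩
  have e : f y / 2 = f (y / 2) := by simp [map_ofNat f 2]
  simp only [HasCoords, e]
  exact hφ x (y / 2) h

section
variable {A : Type*} [Field A]

theorem HasCoords.unique {g2 g3 : A} {P : Pt g2 g3} {x y x' y' : A} [NeZero (2 : A)]
    (h : HasCoords P x y) (h' : HasCoords P x' y') : x = x' ∧ y = y' := by
  obtain ⟨h, rfl⟩ := h
  obtain ⟨h', e⟩ := h'
  rw [Point.some.injEq] at e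
  refine ⟨e.1, ?_⟩
  have := e.2
  have h2 : (2 : A) ≠ 0 := NeZero.ne _
  field_simp at this
  exact this

theorem HasCoords.of_eq {g2 g3 : A} {P : Pt g2 g3} {x y x' y' : A} (h : HasCoords P x y)
    (hx : x = x') (hy : y = y') : HasCoords P x' y' := by
  subst hx hy
  exact h

theorem HasCoords.eq {g2 g3 : A} {P P' : Pt g2 g3} {x y : A}
    (h : HasCoords P x y) (h' : HasCoords P' x y) : P = P' := by
  obtain ⟨h, rfl⟩ := h
  obtain ⟨h', rfl⟩ := h'
  rfl

theorem exists_hasCoords {g2 g3 : A} [NeZero (2 : A)] {P : Pt g2 g3} (h : P ≠ 0) :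
    ∃ x y, HasCoords P x y := by
  rcases P with _ | ⟨x, y, h'⟩
  · exact absurd rfl h
  · have h2 : (2 : A) ≠ 0 := NeZero.ne _
    refine ⟨x, y * 2, ?_⟩
    simp only [HasCoords, mul_div_cancel_right₀ _ h2]
    exact ⟨h', trivial⟩

theorem HasCoords.equation [CharZero A] {g2 g3 : A} {P : Pt g2 g3} {x y : A}
    (h : HasCoords P x y) : y ^ 2 = 4 * x ^ 3 + g2 * x - g3 := by
  obtain ⟨h, rfl⟩ := h
  have := (equation_iff _ _).1 h.1
  simp only [curve] at this
  linear_combination 4 * this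

theorem not_hasCoords_zero {g2 g3 x y : A} : ¬ HasCoords (0 : Pt g2 g3) x y := by
  rintro ⟨h, e⟩
  cases e

open Classical in
theorem HasCoords.neg {g2 g3 : A} {P : Pt g2 g3} {x y : A} (h : HasCoords P x y) :
    HasCoords (-P) x (-y) := by
  obtain ⟨h, rfl⟩ := h
  have e : (curve g2 g3).negY x (y / 2) = -y / 2 := by
    simp only [negY, curve]
    ring
  rw [Point.neg_some]
  refine ⟨e ▸ (nonsingular_neg ..).2 h, ?_⟩
  congr 1

open Classical in
/-- The addition of two points with different first coordinates. -/
theorem HasCoords.add {g2 g3 : A} [CharZero A] {P Q : Pt g2 g3} {x y z w : A}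
    (h : HasCoords P x y) (h' : HasCoords Q z w) (hxz : x ≠ z) :
    HasCoords (P + Q) (((y - w) / (2 * (x - z))) ^ 2 - x - z)
      (-((y - w) / (x - z) * (((y - w) / (2 * (x - z))) ^ 2 - x - z - x) + y)) := by
  obtain ⟨h, rfl⟩ := h
  obtain ⟨h', rfl⟩ := h'
  have hd := sub_ne_zero.2 hxz
  have hX : (curve g2 g3).addX x z ((curve g2 g3).slope x z (y / 2) (w / 2)) =
      (((y - w) / (2 * (x - z))) ^ 2 - x - z) := by
    rw [slope_of_X_ne hxz]
    simp only [addX, curve]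
    field_simp
    ring
  have hY : (curve g2 g3).addY x z (y / 2) ((curve g2 g3).slope x z (y / 2) (w / 2)) =
      -((y - w) / (x - z) * (((y - w) / (2 * (x - z))) ^ 2 - x - z - x) + y) / 2 := by
    simp only [addY, negAddY, hX, negY]
    rw [slope_of_X_ne hxz]
    simp only [curve]
    field_simp
    ring
  have := nonsingular_add h h' (fun e => hxz e.1)
  rw [hX, hY] at this
  refine ⟨this, ?_⟩
  rw [Point.add_of_X_ne hxz]
  simp only [hX, hY]

open Classical in
/-- The doubling of a point that is not of order two. -/
theorem HasCoords.double {g2 g3 : A} [CharZero A] {P : Pt g2 g3} {x y : A}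
    (h : HasCoords P x y) (hy : y ≠ 0) :
    HasCoords (P + P) (((12 * x ^ 2 + g2) / (4 * y)) ^ 2 - 2 * x)
      (-((12 * x ^ 2 + g2) / (2 * y) * (((12 * x ^ 2 + g2) / (4 * y)) ^ 2 - 2 * x - x) + y)) := by
  obtain ⟨h, rfl⟩ := h
  have hn : y / 2 ≠ (curve g2 g3).negY x (y / 2) := by
    simp only [negY, curve]
    intro e
    apply hy
    linear_combination e
  have hs : (curve g2 g3).slope x x (y / 2) (y / 2) = (12 * x ^ 2 + g2) / (4 * y) := by
    rw [slope_of_Y_ne rfl hn]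
    simp only [negY, curve]
    have : y / 2 - (-(y / 2) - 0 * x - 0) = y := by ring
    rw [this]
    field_simp
    ring
  have hX : (curve g2 g3).addX x x ((curve g2 g3).slope x x (y / 2) (y / 2)) =
      (((12 * x ^ 2 + g2) / (4 * y)) ^ 2 - 2 * x) := by
    rw [hs]
    simp only [addX, curve]
    ring
  have hY : (curve g2 g3).addY x x (y / 2) ((curve g2 g3).slope x x (y / 2) (y / 2)) =
      -((12 * x ^ 2 + g2) / (2 * y) * (((12 * x ^ 2 + g2) / (4 * y)) ^ 2 - 2 * x - x) + y) / 2 := by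
    simp only [addY, negAddY, hX, negY]
    rw [hs]
    simp only [curve]
    field_simp
    ring
  have := nonsingular_add h h (fun e => hn e.2)
  rw [hX, hY] at this
  refine ⟨this, ?_⟩
  rw [Point.add_self_of_Y_ne hn]
  simp only [hX, hY]

/-- Nonsingularity of the point: the two partial derivatives do not vanish together. It allows a
logarithmic derivative to be cancelled even at points of order two. -/
theorem HasCoords.disc [CharZero A] {g2 g3 : A} {P : Pt g2 g3} {x y : A}
    (h : HasCoords P x y) : y ≠ 0 ∨ 12 * x ^ 2 + g2 ≠ 0 := by
  obtain ⟨h, rfl⟩ := h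
  have := ((nonsingular_iff _ _).1 h).2
  simp only [curve] at this
  by_contra! hh
  rcases this with h1 | h1
  · apply h1
    linear_combination -hh.2 / 4
  · apply h1
    linear_combination hh.1

end

end Weierstrass

/-! ### The logarithmic derivative of a point. -/

namespace Weierstrass

variable {A : Type*} [Field A] [Differential A]

theorem derivation_div (x y : A) (hy : y ≠ 0) : (x / y)′ = (x′ * y - x * y′) / y ^ 2 := by
  have h : (x / y * y)′ = x′ := by rw [div_mul_cancel₀ _ hy]
  rw [Derivation.leibniz] at h
  simp only [smul_eq_mul] at h
  field_simp
  rw [← h]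
  field_simp
  ring

theorem derivation_mul (x y : A) : (x * y)′ = x * y′ + y * x′ := by
  rw [Derivation.leibniz]; rfl

theorem derivation_sq (x : A) : (x ^ 2)′ = 2 * x * x′ := by
  rw [sq, derivation_mul]; ring

theorem derivation_ofNat (n : ℕ) [n.AtLeastTwo] : (ofNat(n) : A)′ = 0 := by
  have := Derivation.map_natCast (D := (Differential.deriv : Derivation ℤ A A)) (OfNat.ofNat n)
  simpa using this

/-- The logarithmic derivative of the point `P` of the curve `y² = 4x³ + g₂x - g₃` with respect to
the invariant differential `dx/y` is `κ`. -/
def HasLogDeriv {g2 g3 : A} (κ : A) (P : Pt g2 g3) : Prop :=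
  (P = 0 ∧ κ = 0) ∨ ∃ x y, HasCoords P x y ∧ x′ = κ * y ∧ y′ = κ * (6 * x ^ 2 + g2 / 2)

variable [CharZero A] {g2 g3 : A}

/-- At a point of order two y = 0 and the equation for x′ says nothing about κ; the equation for y′
then determines it, which is why the definition carries both. -/
theorem HasLogDeriv.unique {κ l : A} {P : Pt g2 g3} (h : HasLogDeriv κ P) (h' : HasLogDeriv l P) :
    κ = l := by
  rcases h with ⟨rfl, rfl⟩ | ⟨x, y, h, h1, h2⟩ <;> rcases h' with ⟨h0, rfl⟩ | ⟨z, w, h', h3, h4⟩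
  · rfl
  · exact absurd h' not_hasCoords_zero
  · subst h0
    exact absurd h not_hasCoords_zero
  · obtain ⟨rfl, rfl⟩ := h.unique h'
    rcases h.disc with hy | hx
    · exact mul_right_cancel₀ hy (h1.symm.trans h3)
    · have : 6 * x ^ 2 + g2 / 2 ≠ 0 := by
        intro e
        apply hx
        linear_combination 2 * e
      exact mul_right_cancel₀ this (h2.symm.trans h4)

open Classical in
theorem HasLogDeriv.neg {κ : A} {P : Pt g2 g3} (h : HasLogDeriv κ P) : HasLogDeriv (-κ) (-P) := by
  rcases h with ⟨rfl, rfl⟩ | ⟨x, y, h, h1, h2⟩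
  · exact Or.inl ⟨neg_zero, neg_zero⟩
  · refine Or.inr ⟨x, -y, h.neg, by rw [h1]; ring, ?_⟩
    rw [map_neg, h2]; ring

-- Translation invariance of dx/y, verified on the chord and tangent formulas by differentiating the
-- slope.
open Classical in
theorem HasLogDeriv.add (hg2 : g2′ = 0) {κ l : A} {P Q : Pt g2 g3}
    (hP : HasLogDeriv κ P) (hQ : HasLogDeriv l Q) : HasLogDeriv (κ + l) (P + Q) := by
  rcases hP with ⟨rfl, rfl⟩ | ⟨x, y, h, h1, h2⟩
  · simpa using hQ
  rcases hQ with ⟨rfl, rfl⟩ | ⟨z, w, h', h3, h4⟩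
  · rw [add_zero, add_zero]
    exact Or.inr ⟨x, y, h, h1, h2⟩
  have E := h.equation
  have E' := h'.equation
  by_cases hxz : x = z
  · subst hxz
    have hyw : (y - w) * (y + w) = 0 := by linear_combination E - E'
    rcases mul_eq_zero.1 hyw with e | e
    · obtain rfl : y = w := sub_eq_zero.1 e
      obtain rfl := h.eq h'
      obtain rfl : κ = l :=
        HasLogDeriv.unique (P := P) (Or.inr ⟨x, y, h, h1, h2⟩) (Or.inr ⟨x, y, h, h3, h4⟩)
      by_cases hy : y = 0
      -- A point of order two: the sum is 0, and y = 0 gives y′ = 0, which forces κ = 0.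
      · subst hy
        refine Or.inl ⟨?_, ?_⟩
        · have : P = -P := h.eq (by simpa using h.neg)
          nth_rewrite 2 [this]
          exact add_neg_cancel P
        · have hd := h.disc.resolve_left (by simp)
          have : κ = 0 := by
            rw [map_zero] at h2
            rcases mul_eq_zero.1 h2.symm with h0 | h0
            · exact h0
            · exact absurd (by linear_combination 2 * h0) hd
          rw [this, add_zero]
      · have hd := h.double hy
        set s := (12 * x ^ 2 + g2) / (4 * y) with hs
        have hs' : (12 * x ^ 2 + g2) / (2 * y) = 2 * s := by rw [hs]; field_simp; ring
        rw [hs'] at hd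
        have hsy : s * (4 * y) = 12 * x ^ 2 + g2 := by rw [hs]; field_simp
        -- Differentiate `hsy`, then use it again in the form 6x² + g₂/2 = 2sy.
        have hds : s′ = κ * (6 * x - 2 * s ^ 2) := by
          have := congrArg (fun t : A => t′) hsy
          simp only [derivation_mul, map_add, derivation_sq, derivation_ofNat, hg2, h1, h2] at this
          have h4 : s′ * (4 * y) = κ * (6 * x - 2 * s ^ 2) * (4 * y) := by
            linear_combination this + κ * 2 * s * hsy
          exact mul_right_cancel₀ (by simpa using hy) h4
        refine Or.inr ⟨_, _, hd, ?_, ?_⟩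
        · simp only [map_sub, derivation_mul, derivation_sq, derivation_ofNat, hds, h1]
          ring
        · simp only [map_sub, map_add, map_neg, derivation_mul, derivation_sq, derivation_ofNat, hds, h1, h2]
          linear_combination 3 / 2 * κ * hsy
    · obtain rfl : w = -y := by linear_combination e
      have hPQ : Q = -P := h'.eq h.neg
      refine Or.inl ⟨by rw [hPQ]; exact add_neg_cancel P, ?_⟩
      have := HasLogDeriv.unique (P := Q) (Or.inr ⟨x, -y, h', h3, h4⟩)
        (hPQ ▸ HasLogDeriv.neg (P := P) (Or.inr ⟨x, y, h, h1, h2⟩))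
      rw [this]; ring
  · have hd := h.add h' hxz
    have hne := sub_ne_zero.2 hxz
    set s := (y - w) / (2 * (x - z)) with hs
    have hs' : (y - w) / (x - z) = 2 * s := by rw [hs]; field_simp
    rw [hs'] at hd
    have hsy : s * (2 * (x - z)) = y - w := by rw [hs]; field_simp
    -- The second expression of the slope: subtract the two curve equations and divide by x - z.
    have hsum : s * (y + w) = 2 * (x ^ 2 + x * z + z ^ 2) + g2 / 2 := by
      have : s * (y + w) * (2 * (x - z)) =
          (2 * (x ^ 2 + x * z + z ^ 2) + g2 / 2) * (2 * (x - z)) := by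
        linear_combination (y + w) * hsy + E - E'
      exact mul_right_cancel₀ (by simpa using hne) this
    have hds : s′ = κ * (2 * x + z - s ^ 2) + l * (2 * z + x - s ^ 2) := by
      have := congrArg (fun t : A => t′) hsy
      simp only [derivation_mul, map_sub, derivation_ofNat, h1, h2, h3, h4] at this
      have h5 : s′ * (2 * (x - z)) =
          (κ * (2 * x + z - s ^ 2) + l * (2 * z + x - s ^ 2)) * (2 * (x - z)) := by
        linear_combination this + (l - κ) * hsum + (κ + l) * s * hsy
      exact mul_right_cancel₀ (by simpa using hne) h5
    refine Or.inr ⟨_, _, hd, ?_, ?_⟩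
    · simp only [map_sub, derivation_sq, hds, h1, h3]
      linear_combination -l * hsy
    · simp only [map_sub, map_add, map_neg, derivation_mul, derivation_sq, derivation_ofNat, hds,
        h1, h2, h3]
      linear_combination (2 * κ + l) * hsum + (l - 2 * κ) * s * hsy

end Weierstrass

/-! ### Algebraic closedness, generators, and extension of embeddings. -/

/-- A polynomial of positive degree is a differential polynomial of order 0, and Blum's axiom
applies to it with the inequation 1 ≠ 0. -/
theorem IsDifferentiallyClosed.isAlgClosed {A : Type*} [Field A] [Differential A]
    (h : IsDifferentiallyClosed A) : IsAlgClosed A := by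
  refine IsAlgClosed.of_exists_root _ fun p _ hp => ?_
  let f : MvPolynomial ℕ A := Polynomial.toMvPolynomial 0 p
  have hsub : f.vars ⊆ {0} := by
    rw [show f = _ from DFunLike.congr_fun (Polynomial.toMvPolynomial_eq_rename_comp (R := A) 0) p]
    exact (MvPolynomial.vars_rename _ _).trans (by intro i hi; simp at hi; simp [hi])
  have hmem : 0 ∈ f.vars := by
    by_contra h0
    have he : f.vars = ∅ := by
      rw [Finset.eq_empty_iff_forall_notMem]
      intro i hi
      have := Finset.mem_singleton.1 (hsub hi)
      exact h0 (this ▸ hi)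
    obtain ⟨r, hr⟩ : ∃ r, f = MvPolynomial.C r := ⟨_, MvPolynomial.vars_eq_empty_iff_eq_C.1 he⟩
    rw [← Polynomial.toMvPolynomial_C 0 r] at hr
    have : p = Polynomial.C r := Polynomial.toMvPolynomial_injective _ hr
    exact hp.natDegree_pos.ne' (by rw [this, Polynomial.natDegree_C])
  obtain ⟨a, ha, -⟩ := h f 1 0 hmem (fun i hi => (Finset.mem_singleton.1 (hsub hi)).le) one_ne_zero
    (by simp)
  exact ⟨a, by simpa [f, MvPolynomial.eval_toMvPolynomial] using ha⟩

namespace DiffSubfield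

theorem deriv_mem_closure {A : Type*} [Field A] [Differential A] {S : Set A}
    (hS : ∀ s ∈ S, s′ ∈ Subfield.closure S) {x : A} (hx : x ∈ Subfield.closure S) :
    x′ ∈ Subfield.closure S := by
  induction hx using Subfield.closure_induction with
  | mem x hx => exact hS x hx
  | one => simp
  | add x y _ _ hx hy => rw [map_add]; exact add_mem hx hy
  | neg x _ hx => rw [map_neg]; exact neg_mem hx
  | mul x y hx' hy' hx hy =>
    rw [derivation_mul]
    exact add_mem (mul_mem hx' hy) (mul_mem hy' hx)
  | inv x hx' hx =>
    by_cases h0 : x = 0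
    · simp [h0]
    · rw [← one_div, derivation_div _ _ h0]
      refine div_mem (sub_mem (mul_mem ?_ hx') (mul_mem (one_mem _) hx)) (pow_mem hx' 2)
      simp

theorem isAlgebraic_of_mem_closure {A R : Type*} [Field A] [CommRing R] [IsDomain R] [Algebra R A]
    {S : Set A} (hS : ∀ s ∈ S, IsAlgebraic R s) {x : A} (hx : x ∈ Subfield.closure S) :
    IsAlgebraic R x := by
  induction hx using Subfield.closure_induction with
  | mem x hx => exact hS x hx
  | one => exact isAlgebraic_one
  | add x y _ _ hx hy => exact hx.add hy
  | neg x _ hx => exact hx.neg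
  | mul x y _ _ hx hy => exact hx.mul hy
  | inv x _ hx => exact hx.inv

variable {A : Type*} [Field A] [Differential A]

theorem gen_le {S : Set A} {F : DiffSubfield A} (h : S ⊆ F) : gen S ≤ F :=
  fun _ hx => mem_gen.1 hx F.toSubfield ⟨h, fun _ => F.deriv_mem⟩

/-- Once the derivatives of the generators are rational in the generators, differential generation
is plain field generation. -/
theorem mem_gen_iff_mem_closure {S : Set A} (hS : ∀ s ∈ S, s′ ∈ Subfield.closure S) {x : A} :
    x ∈ gen S ↔ x ∈ Subfield.closure S :=
  ⟨fun hx => mem_gen.1 hx _ ⟨Subfield.subset_closure, fun _ => deriv_mem_closure hS⟩,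
    fun hx => Subfield.closure_le (t := (gen S).toSubfield).2 (subset_gen S) hx⟩

theorem mem_adjoin_iff_mem_closure (K : DiffSubfield A) (S : Set A) {x : A} :
    x ∈ IntermediateField.adjoin K S ↔ x ∈ Subfield.closure ((K : Set A) ∪ S) := by
  have : Set.range (algebraMap K A) = K := Subtype.range_coe
  rw [← this]
  rfl

/-- The subfield of the elements at which a homomorphism commutes with the derivations. -/
def derivEqLocus {M B : Type*} [Field M] [Differential M] [Field B] [Differential B]
    (τ : M →+* B) : Subfield M where
  carrier := {x | τ (x′) = (τ x)′}
  zero_mem' := by simp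
  one_mem' := by simp
  add_mem' := fun {x y} (hx : _ = _) (hy : _ = _) => by simp [hx, hy]
  neg_mem' := fun {x} (hx : _ = _) => by simp [hx]
  mul_mem' := fun {x y} (hx : _ = _) (hy : _ = _) => by
    change τ ((x * y)′) = ((τ (x * y))′)
    simp only [derivation_mul, map_add, map_mul, hx, hy]
  inv_mem' := fun x (hx : _ = _) => by
    by_cases h0 : x = 0
    · simp [h0]
    · have h1 : τ x ≠ 0 := by simpa using h0
      change τ ((x⁻¹)′) = ((τ x⁻¹)′)
      rw [map_inv₀ τ, ← one_div, ← one_div, derivation_div _ _ h0, derivation_div _ _ h1]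
      simp [hx]

/-- Used to check on generators that a homomorphism respects the derivation, has values in a given
field, or equals another one. -/
theorem le_subfield_of_mem_closure {S : Set A} {M : DiffSubfield A}
    (hM : ∀ x ∈ M, x ∈ Subfield.closure S) (E : Subfield M)
    (hE : ∀ x : M, (x : A) ∈ S → x ∈ E) (hS : ∀ x ∈ S, x ∈ M) (x : M) : x ∈ E := by
  have h : Subfield.closure S ≤ E.map M.toSubfield.subtype :=
    Subfield.closure_le.2 fun x hx => ⟨⟨x, hS x hx⟩, hE ⟨x, hS x hx⟩ hx, rfl⟩
  obtain ⟨y, hy, e⟩ := h (hM x x.2)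
  obtain rfl : y = x := Subtype.ext e
  exact hy

/-- The defect δ = τ∘D - D∘τ is a derivation along τ that vanishes on E. Hence 0 = δ(p(x)) =
τ(p′(x)) δ(x) for p the minimal polynomial of x, and p′(x) ≠ 0 by separability. -/
theorem map_deriv_of_isAlgebraic {E M B : Type*} [Field E] [Field M] [Field B] [Differential M]
    [Differential B] [Algebra E M] [CharZero E] (τ : M →+* B)
    (hE : ∀ e : E, τ ((algebraMap E M e)′) = (τ (algebraMap E M e))′) {x : M}
    (hx : IsAlgebraic E x) : τ (x′) = (τ x)′ := by
  have key : ∀ p : Polynomial E, τ ((Polynomial.aeval x p)′) - (τ (Polynomial.aeval x p))′ =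
      τ (Polynomial.aeval x p.derivative) * (τ (x′) - (τ x)′) := by
    intro p
    induction p using Polynomial.induction_on with
    | C e => simp [hE]
    | add p q hp hq =>
      simp only [map_add, add_mul, ← hp, ← hq]
      ring
    | monomial n e h =>
      rw [pow_succ, ← mul_assoc]
      set q := Polynomial.C e * Polynomial.X ^ n
      simp only [map_mul, Polynomial.aeval_X, derivation_mul, Polynomial.derivative_mul, map_add,
        Polynomial.derivative_X, mul_one]
      linear_combination τ x * h
  have h0 : τ (Polynomial.aeval x (minpoly E x).derivative) ≠ 0 := by
    rw [map_ne_zero]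
    have hx' := hx.isIntegral
    have hs := (minpoly.irreducible hx').separable
    exact hs.aeval_derivative_ne_zero (minpoly.aeval E x)
  have := key (minpoly E x)
  simp only [minpoly.aeval, map_zero, sub_zero] at this
  exact sub_eq_zero.1 ((mul_eq_zero.1 this.symm).resolve_left h0)

/-- Families with the same polynomial relations generate isomorphic fields: a fraction r(q)/s(q) is
sent to r(q′)/s(q′), and the equivalence of relations makes this well defined. -/
theorem exists_algHom_adjoin_range {F B ι : Type*} [Field F] [Field B] [Algebra F B]
    (q q' : ι → B)
    (h : ∀ f : MvPolynomial ι F, MvPolynomial.aeval q f = 0 ↔ MvPolynomial.aeval q' f = 0) :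
    ∃ τ : IntermediateField.adjoin F (Set.range q) →+* B,
      (∀ x : F, τ (algebraMap F _ x) = algebraMap F B x) ∧
      ∀ i, τ ⟨q i, IntermediateField.subset_adjoin F _ ⟨i, rfl⟩⟩ = q' i := by
  have hdiv (r s r' s' : MvPolynomial ι F) (hs : MvPolynomial.aeval q s ≠ 0)
      (hs' : MvPolynomial.aeval q s' ≠ 0)
      (he : MvPolynomial.aeval q r / MvPolynomial.aeval q s =
        MvPolynomial.aeval q r' / MvPolynomial.aeval q s') :
      MvPolynomial.aeval q' r / MvPolynomial.aeval q' s =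
        MvPolynomial.aeval q' r' / MvPolynomial.aeval q' s' := by
    rw [div_eq_div_iff hs hs', ← sub_eq_zero, ← map_mul, ← map_mul, ← map_sub, h] at he
    rw [Ne, h] at hs hs'
    rw [div_eq_div_iff hs hs', ← sub_eq_zero, ← map_mul, ← map_mul, ← map_sub, he]
  have hex (x : IntermediateField.adjoin F (Set.range q)) : ∃ r s : MvPolynomial ι F,
      MvPolynomial.aeval q s ≠ 0 ∧ (x : B) = MvPolynomial.aeval q r / MvPolynomial.aeval q s := by
    obtain ⟨r, s, e⟩ := (IntermediateField.mem_adjoin_range_iff F q x).1 x.2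
    by_cases hs : MvPolynomial.aeval q s = 0
    · exact ⟨0, 1, by simp, by simp [e, hs]⟩
    · exact ⟨r, s, hs, e⟩
  choose r s hs he using hex
  have hτ (x : IntermediateField.adjoin F (Set.range q)) (r' s' : MvPolynomial ι F) (hs' : MvPolynomial.aeval q s' ≠ 0)
      (e : (x : B) =
        MvPolynomial.aeval q r' / MvPolynomial.aeval q s') :
      MvPolynomial.aeval q' (r x) / MvPolynomial.aeval q' (s x) =
        MvPolynomial.aeval q' r' / MvPolynomial.aeval q' s' :=
    hdiv _ _ _ _ (hs x) hs' ((he x).symm.trans e)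
  have hs0 (x) : MvPolynomial.aeval q' (s x) ≠ 0 := fun h0 => hs x ((h _).2 h0)
  refine ⟨{ toFun x := MvPolynomial.aeval q' (r x) / MvPolynomial.aeval q' (s x)
            map_one' := ?_, map_mul' x y := ?_, map_zero' := ?_, map_add' x y := ?_ }, fun x => ?_,
          fun i => ?_⟩
  · rw [hτ 1 1 1 (by simp) (by simp)]
    simp
  · rw [hτ (x * y) (r x * r y) (s x * s y) (by simp [hs]) (by simp [he x, he y, div_mul_div_comm]),
      map_mul, map_mul, div_mul_div_comm]
  · rw [hτ 0 0 1 (by simp) (by simp)]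
    simp
  · rw [hτ (x + y) (r x * s y + s x * r y) (s x * s y) (by simp [hs])
      (by simp [he x, he y, div_add_div _ _ (hs x) (hs y)])]
    simp only [map_add, map_mul, div_add_div _ _ (hs0 x) (hs0 y)]
  · refine (hτ _ (MvPolynomial.C x) 1 (by simp) ?_).trans (by simp)
    simp
  · exact (hτ _ (MvPolynomial.X i) 1 (by simp) (by simp)).trans (by simp)

end DiffSubfield

theorem exists_ringHom_extend_of_isAlgebraic {E S B : Type*} [Field E] [Field S] [Algebra E S]
    [Algebra.IsAlgebraic E S] [Field B] [IsAlgClosed B] (ρ : E →+* B) :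
    ∃ τ : S →+* B, ∀ x, τ (algebraMap E S x) = ρ x := by
  let := ρ.toAlgebra
  exact ⟨(IsAlgClosed.lift : S →ₐ[E] B).toRingHom, fun x => (IsAlgClosed.lift : S →ₐ[E] B).commutes x⟩

/-- The exchange property of algebraic dependence. -/
theorem isAlgebraic_adjoin_exchange {F B : Type*} [Field F] [Field B] [Algebra F B] {a c : B}
    (hc : Transcendental F c) (h : IsAlgebraic (Algebra.adjoin F {a}) c) :
    IsAlgebraic (Algebra.adjoin F {c}) a := by
  by_contra ha
  by_cases hac : a = c
  · subst hac
    exact ha (isAlgebraic_algebraMap (⟨a, Algebra.subset_adjoin rfl⟩ : Algebra.adjoin F {a}))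
  have h1 : AlgebraicIndepOn F (id : B → B) {c} := by
    have : Unique ({c} : Set B) := Set.uniqueSingleton c
    have hc' : Transcendental F (id ((default : ({c} : Set B)) : B)) := by
      rwa [id, Set.mem_singleton_iff.1 (default : ({c} : Set B)).2]
    exact algebraicIndependent_unique_type_iff.2 hc'
  have h2 : AlgebraicIndepOn F (id : B → B) {a, c} :=
    AlgebraicIndepOn.insert h1 (by rw [Set.image_id]; exact ha)
  rw [Set.pair_comm, AlgebraicIndepOn.insert_iff (by simpa using Ne.symm hac)] at h2
  exact h2.2 (by rw [Set.image_id]; exact h)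

/-! ### The function field of the curve. -/

/-- A polynomial function on the curve `y² = 4x³ + g₂x - g₃` has the form `p(x) + q(x)y`. -/
theorem exists_reduction {F : Type*} [Field F] (g2 g3 : F) (f : MvPolynomial (Fin 2) F) :
    ∃ p q : Polynomial F, ∀ (B : Type u) [Field B] [Algebra F B] (x y : B),
      y ^ 2 = 4 * x ^ 3 + algebraMap F B g2 * x - algebraMap F B g3 →
      MvPolynomial.aeval ![x, y] f = Polynomial.aeval x p + Polynomial.aeval x q * y := by
  induction f using MvPolynomial.induction_on with
  | C r => exact ⟨Polynomial.C r, 0, fun B _ _ x y h => by simp⟩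
  | add f g hf hg =>
    obtain ⟨p, q, h⟩ := hf
    obtain ⟨p', q', h'⟩ := hg
    refine ⟨p + p', q + q', fun B _ _ x y e => ?_⟩
    rw [map_add, h B x y e, h' B x y e, map_add, map_add]
    ring
  | mul_X f i hf =>
    obtain ⟨p, q, h⟩ := hf
    fin_cases i
    · refine ⟨p * .X, q * .X, fun B _ _ x y e => ?_⟩
      simp [h B x y e]
      ring
    · refine ⟨q * (.C 4 * .X ^ 3 + .C g2 * .X - .C g3), p, fun B _ _ x y e => ?_⟩
      simp [h B x y e, map_ofNat (algebraMap F B) 4]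
      linear_combination Polynomial.aeval x q * e

/-- The norm p² - q²(4x³ + g₂x - g₃) vanishes; comparing degrees, an even number would equal an even
number plus 3 unless q = 0. -/
theorem reduction_eq_zero {F B : Type*} [Field F] [CharZero F] [Field B] [Algebra F B] {g2 g3 : F}
    {x y : B}
    (e : y ^ 2 = 4 * x ^ 3 + algebraMap F B g2 * x - algebraMap F B g3) (hx : Transcendental F x)
    {p q : Polynomial F} (h : Polynomial.aeval x p + Polynomial.aeval x q * y = 0) :
    p = 0 ∧ q = 0 := by
  have h1 : p ^ 2 = q ^ 2 * (.C 4 * .X ^ 3 + .C g2 * .X - .C g3) := by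
    rw [← sub_eq_zero]
    refine (transcendental_iff.1 hx) _ ?_
    simp only [map_sub, map_mul, map_pow, map_add, Polynomial.aeval_C, Polynomial.aeval_X, map_ofNat]
    linear_combination (Polynomial.aeval x p - Polynomial.aeval x q * y) * h +
      Polynomial.aeval x q ^ 2 * e
  have h3 : (.C 4 * .X ^ 3 + .C g2 * .X - .C g3 : Polynomial F).natDegree = 3 := by
    compute_degree!
  have hw : (.C 4 * .X ^ 3 + .C g2 * .X - .C g3 : Polynomial F) ≠ 0 := by
    intro h0
    rw [h0] at h3
    simp at h3
  by_cases hq : q = 0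
  · subst hq
    exact ⟨by simpa using h1, rfl⟩
  · have := congrArg Polynomial.natDegree h1
    rw [Polynomial.natDegree_mul (pow_ne_zero 2 hq) hw, h3, Polynomial.natDegree_pow,
      Polynomial.natDegree_pow] at this
    omega


/-! ### Constants of a Weierstrass extension. -/

namespace DiffSubfield

variable {A : Type u} [Field A] [CharZero A] [Differential A]

theorem deriv_curve {g2 g3 k a y : A} (hg2 : g2′ = 0) (hg3 : g3′ = 0)
    (hy : y ^ 2 = 4 * a ^ 3 + g2 * a - g3) (hay : a′ = k * y) (hy0 : y ≠ 0) :
    y′ = k * (6 * a ^ 2 + g2 / 2) := by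
  have h := congrArg (fun t : A => t′) hy
  have h3 : a ^ 3 = a * a ^ 2 := by ring
  simp only [h3, derivation_sq, derivation_mul, map_add, map_sub, hg2, hg3, hay,
    derivation_ofNat] at h
  apply mul_left_cancel₀ (mul_ne_zero two_ne_zero hy0)
  linear_combination h

/-- The field K(a, y) is already closed under the derivation, because y′ is a polynomial in a over
K, or 0 when y = 0. -/
theorem mem_gen_iff_mem_closure_pair {K : DiffSubfield A} {g2 g3 k a y : A} (hk : k ∈ K)
    (hk0 : k ≠ 0) (hg2 : g2 ∈ constants K) (hg3 : g3 ∈ constants K)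
    (hy : y ^ 2 = 4 * a ^ 3 + g2 * a - g3) (hay : a′ = k * y) {x : A} :
    x ∈ gen ((K : Set A) ∪ {a}) ↔ x ∈ Subfield.closure ((K : Set A) ∪ {a, y}) := by
  set S : Set A := (K : Set A) ∪ {a, y}
  have hKS {z : A} (hz : z ∈ K) : z ∈ Subfield.closure S := Subfield.subset_closure (Or.inl hz)
  have haS : a ∈ Subfield.closure S := Subfield.subset_closure (by simp [S])
  have hyS : y ∈ Subfield.closure S := Subfield.subset_closure (by simp [S])
  have hS : ∀ s ∈ S, s′ ∈ Subfield.closure S := by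
    rintro s (hs | rfl | rfl)
    · exact hKS (K.deriv_mem hs)
    · rw [hay]
      exact mul_mem (hKS hk) hyS
    · by_cases hy0 : s = 0
      · simp [hy0]
      · rw [deriv_curve hg2.2 hg3.2 hy hay hy0]
        exact mul_mem (hKS hk) (add_mem (mul_mem (ofNat_mem _ 6) (pow_mem haS 2))
          (div_mem (hKS hg2.1) (ofNat_mem _ 2)))
  rw [← mem_gen_iff_mem_closure hS]
  refine ⟨fun h => gen_le ?_ h, fun h => gen_le ?_ h⟩
  · rintro s (hs | rfl)
    · exact subset_gen _ (Or.inl hs)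
    · exact subset_gen _ (by simp [S])
  · have hKG {z : A} (hz : z ∈ K) : z ∈ gen ((K : Set A) ∪ {a}) := subset_gen _ (Or.inl hz)
    have haG : a ∈ gen ((K : Set A) ∪ {a}) := subset_gen _ (by simp)
    rintro s (hs | rfl | rfl)
    · exact hKG hs
    · exact haG
    · have : s = a′ / k := by rw [hay]; field_simp
      rw [this]
      exact div_mem (deriv_mem _ haG) (hKG hk)

/-- A differential embedding of `E` extends to any algebraic differential extension. -/
theorem exists_differential_extend [IsAlgClosed A] {E L : DiffSubfield A} (h : E ≤ L)
    (halg : ∀ x ∈ L, IsAlgebraic E x) (ρ : E →+* A) (hρ : ∀ x : E, ρ (x′) = (ρ x)′) :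
    ∃ τ : L →+* A, (∀ x : L, τ (x′) = (τ x)′) ∧ ∀ x : E, τ ⟨x, h x.2⟩ = ρ x := by
  let := (Subring.inclusion (R := A) (S := E.toSubring) (T := L.toSubring) h).toAlgebra
  have hT : IsScalarTower E L A := IsScalarTower.of_algebraMap_eq fun _ => rfl
  have hL : Algebra.IsAlgebraic E L :=
    ⟨fun x => (isAlgebraic_algebraMap_iff (algebraMap L A).injective).1 (halg x x.2)⟩
  obtain ⟨τ, hτ⟩ := exists_ringHom_extend_of_isAlgebraic (S := L) ρ
  have hτ' (x : E) : τ ⟨x, h x.2⟩ = ρ x := hτ x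
  refine ⟨τ, fun x => map_deriv_of_isAlgebraic (E := E) τ (fun e => ?_)
    (Algebra.IsAlgebraic.isAlgebraic x), hτ'⟩
  rw [hτ, ← hρ, ← hτ]
  rfl

/-- K is relatively algebraically closed in the function field of the curve. Over K(c) the element a
is still transcendental, so in c·(p + qy) = p′ + q′y the coefficients may be compared, and c is a
quotient of two elements of K. -/
theorem constants_le_of_transcendental {K : DiffSubfield A} {g2 g3 a y : A}
    (hg2 : g2 ∈ K) (hg3 : g3 ∈ K) (hy : y ^ 2 = 4 * a ^ 3 + g2 * a - g3)
    (ha : Transcendental K a) {c : A} (hc : c ∈ Subfield.closure ((K : Set A) ∪ {a, y}))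
    (hcK : IsAlgebraic K c) : c ∈ K := by
  rw [← mem_adjoin_iff_mem_closure] at hc
  have hr : ({a, y} : Set A) = Set.range ![a, y] := by simp [Set.pair_comm]
  rw [hr, IntermediateField.mem_adjoin_range_iff] at hc
  obtain ⟨r, s, e⟩ := hc
  obtain ⟨p, q, hs⟩ := exists_reduction (⟨g2, hg2⟩ : K) ⟨g3, hg3⟩ s
  obtain ⟨p', q', hr⟩ := exists_reduction (⟨g2, hg2⟩ : K) ⟨g3, hg3⟩ r
  replace hs := hs A a y hy
  replace hr := hr A a y hy
  by_cases hs0 : MvPolynomial.aeval ![a, y] s = 0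
  · rw [e, hs0, div_zero]
    exact zero_mem K
  rw [eq_div_iff hs0, hs, hr] at e
  let E := IntermediateField.adjoin K {c}
  have hE : Algebra.IsAlgebraic K E :=
    IntermediateField.isAlgebraic_adjoin_simple hcK.isIntegral
  have haE : Transcendental E a := ha.extendScalars E
  let c' : E := ⟨c, IntermediateField.mem_adjoin_simple_self K c⟩
  have hpq := reduction_eq_zero (F := E) (g2 := algebraMap K E ⟨g2, hg2⟩)
    (g3 := algebraMap K E ⟨g3, hg3⟩) (x := a) (y := y) hy haE
    (p := .C c' * p.map (algebraMap K E) - p'.map (algebraMap K E))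
    (q := .C c' * q.map (algebraMap K E) - q'.map (algebraMap K E)) (by
      simp only [map_sub, map_mul, Polynomial.aeval_C, Polynomial.aeval_map_algebraMap]
      change (c * _ - _) + (c * _ - _) * y = 0
      linear_combination e)
  have key {p p' : Polynomial K}
      (h : .C c' * p.map (algebraMap K E) - p'.map (algebraMap K E) = 0) (hp : p ≠ 0) : c ∈ K := by
    have h1 := congrArg (fun f : Polynomial E => ((f.coeff p.natDegree : E) : A)) h
    simp only [Polynomial.coeff_sub, Polynomial.coeff_C_mul, Polynomial.coeff_map,
      Polynomial.coeff_zero] at h1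
    have h2 : c * (p.coeff p.natDegree : A) = p'.coeff p.natDegree := sub_eq_zero.1 h1
    have h3 : (p.coeff p.natDegree : A) ≠ 0 := by simpa using hp
    rw [eq_div_of_mul_eq h3 h2]
    exact div_mem (p'.coeff _).2 (p.coeff _).2
  by_cases hp : p = 0
  · by_cases hq : q = 0
    · exact absurd (by rw [hs, hp, hq]; simp) hs0
    · exact key hpq.2 hq
  · exact key hpq.1 hp

/-- A strongly normal Weierstrass extension has no new constants. -/
theorem IsStronglyNormal.mem_of_deriv_eq_zero [IsAlgClosed A] {K L : DiffSubfield A}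
    (hL : IsStronglyNormal K L) {g2 g3 k a y : A} (hk : k ∈ K)
    (hk0 : k ≠ 0) (hg2 : g2 ∈ constants K) (hg3 : g3 ∈ constants K)
    (hy : y ^ 2 = 4 * a ^ 3 + g2 * a - g3) (hay : a′ = k * y)
    (ha : L = gen ((K : Set A) ∪ {a})) {c : A} (hcL : c ∈ L) (hc0 : c′ = 0) : c ∈ K := by
  have hLc {x : A} : x ∈ L ↔ x ∈ Subfield.closure ((K : Set A) ∪ {a, y}) := by
    rw [ha]
    exact mem_gen_iff_mem_closure_pair hk hk0 hg2 hg3 hy hay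
  have hya {R : Type u} [CommRing R] [IsDomain R] [Algebra R A]
      (hR : ∀ x ∈ K, IsAlgebraic R x) (haR : IsAlgebraic R a) (x : A) (hx : x ∈ L) :
      IsAlgebraic R x := by
    refine isAlgebraic_of_mem_closure ?_ (hLc.1 hx)
    rintro s (hs | rfl | rfl)
    · exact hR s hs
    · exact haR
    · refine IsAlgebraic.of_pow two_pos ?_
      rw [hy]
      have h4 : IsAlgebraic R (4 : A) := hR 4 (ofNat_mem K 4)
      exact ((h4.mul (haR.pow 3)).add ((hR g2 hg2.1).mul haR)).sub (hR g3 hg3.1)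
  have hKalg (x : A) (hx : x ∈ K) : IsAlgebraic K x := isAlgebraic_algebraMap (⟨x, hx⟩ : K)
  by_cases hcK : IsAlgebraic K c
  · by_cases haK : IsAlgebraic K a
    · let := (Subring.inclusion (R := A) (S := K.toSubring) (T := L.toSubring) hL.le).toAlgebra
      have hT : IsScalarTower K L A := IsScalarTower.of_algebraMap_eq fun _ => rfl
      have hKL : Algebra.IsAlgebraic K L :=
        ⟨fun x => (isAlgebraic_algebraMap_iff (algebraMap L A).injective).1 (hya hKalg haK x x.2)⟩
      have hroot := Algebra.IsAlgebraic.range_eval_eq_rootSet_minpoly A (F := K) (⟨c, hcL⟩ : L)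
      -- Every K-embedding of the algebraic extension L is differential, hence strong, hence fixes
      -- the constant c; so c has no other conjugate.
      have hone : (minpoly K (⟨c, hcL⟩ : L)).rootSet A ⊆ {c} := by
        rw [← hroot]
        rintro _ ⟨ψ, rfl⟩
        refine (hL.strong ψ.toRingHom (fun x => ?_) fun x hx => ?_).1 ⟨c, hcL⟩ ⟨hcL, hc0⟩
        · refine map_deriv_of_isAlgebraic (E := K) ψ.toRingHom (fun e => ?_)
            (Algebra.IsAlgebraic.isAlgebraic x)
          change ψ (algebraMap K L (e′)) = ((ψ (algebraMap K L e))′)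
          rw [ψ.commutes, ψ.commutes]
          rfl
        · exact ψ.commutes ⟨x, hx⟩
      have hint : IsIntegral K (⟨c, hcL⟩ : L) := Algebra.IsIntegral.isIntegral _
      have hcard := Polynomial.card_rootSet_eq_natDegree (K := A)
        (minpoly.irreducible hint).separable (IsAlgClosed.splits _)
      have h1 : (minpoly K (⟨c, hcL⟩ : L)).natDegree ≤ 1 := by
        rw [← hcard, ← Nat.card_eq_fintype_card, Nat.card_coe_set_eq]
        exact (Set.ncard_le_ncard hone).trans (Set.ncard_singleton c).le
      obtain ⟨z, hz⟩ := minpoly.natDegree_eq_one_iff.1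
        (h1.antisymm (minpoly.natDegree_pos hint))
      rw [← show (z : A) = c from congrArg Subtype.val hz]
      exact z.2
    · exact constants_le_of_transcendental hg2.1 hg3.1 hy haK (hLc.1 hcL) hcK
  · exfalso
    -- L has transcendence degree at most 1 over K, so L is algebraic over K(c).
    have hac : IsAlgebraic (Algebra.adjoin K {c}) a := by
      refine isAlgebraic_adjoin_exchange hcK (hya (fun x hx => ?_) ?_ c hcL)
      · exact isAlgebraic_algebraMap (algebraMap K (Algebra.adjoin K {a}) ⟨x, hx⟩)
      · exact isAlgebraic_algebraMap (⟨a, Algebra.subset_adjoin rfl⟩ : Algebra.adjoin K {a})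
    have hEc {x : A} : x ∈ gen ((K : Set A) ∪ {c}) ↔ x ∈ Subfield.closure ((K : Set A) ∪ {c}) := by
      refine mem_gen_iff_mem_closure ?_
      rintro s (hs | rfl)
      · exact Subfield.subset_closure (Or.inl (K.deriv_mem hs))
      · simp [hc0]
    set E := gen ((K : Set A) ∪ {c}) with hE
    have hEL : E ≤ L := gen_le (by
      rintro s (hs | rfl)
      · exact hL.le hs
      · exact hcL)
    have hKE {x : A} (hx : x ∈ K) : x ∈ E := subset_gen _ (Or.inl hx)
    have hcE : c ∈ E := subset_gen _ (by simp)
    have haE : IsAlgebraic E a := by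
      let f : Algebra.adjoin K {c} →+* E := (Algebra.adjoin K {c}).val.toRingHom.codRestrict
        E.toSubfield.toSubring (fun x => by
          have : Algebra.adjoin K {c} ≤ (IntermediateField.adjoin K {c}).toSubalgebra :=
            IntermediateField.algebra_adjoin_le_adjoin K {c}
          exact hEc.2 ((mem_adjoin_iff_mem_closure _ _).1 (this x.2)))
      let := f.toAlgebra
      have : IsScalarTower (Algebra.adjoin K {c}) E A := IsScalarTower.of_algebraMap_eq fun _ => rfl
      refine hac.extendScalars (fun x y h => Subtype.ext ?_)
      exact congrArg (fun z : E => (z : A)) h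
    -- Both c and c + 1 are constants transcendental over K, so c ↦ c + 1 is a differential
    -- embedding of K(c). Its extension to L moves a constant of L.
    obtain ⟨ρ', hρ'K, hρ'c⟩ := exists_algHom_adjoin_range (F := K) (fun _ : Unit => c)
      (fun _ => c + 1) (by
        have hc1 : Transcendental K (c + 1) := fun h => hcK (by simpa using h.sub isAlgebraic_one)
        have hi : AlgebraicIndependent K (fun _ : Unit => c) :=
          algebraicIndependent_unique_type_iff.2 hcK
        have hi1 : AlgebraicIndependent K (fun _ : Unit => c + 1) :=
          algebraicIndependent_unique_type_iff.2 hc1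
        exact fun f => (map_eq_zero_iff _ hi).trans (map_eq_zero_iff _ hi1).symm)
    obtain ⟨ρ, hρK, hρc⟩ : ∃ ρ : E →+* A, (∀ x : E, (x : A) ∈ K → ρ x = x) ∧
        ρ ⟨c, hcE⟩ = c + 1 := by
      have hmem (x : E) : E.toSubfield.subtype x ∈
          (IntermediateField.adjoin K (Set.range fun _ : Unit => c)).toSubring := by
        change _ ∈ IntermediateField.adjoin K _
        rw [Set.range_const, mem_adjoin_iff_mem_closure]
        exact hEc.1 x.2
      refine ⟨ρ'.comp (E.toSubfield.subtype.codRestrict _ hmem), fun x hx => hρ'K ⟨x, hx⟩, hρ'c ()⟩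
    have hρ (x : E) : ρ (x′) = (ρ x)′ := by
      refine le_subfield_of_mem_closure (fun x => hEc.1) (derivEqLocus ρ) ?_ 
        (fun x hx => subset_gen _ hx) x
      rintro x (hx | hx)
      · change ρ (x′) = ((ρ x)′)
        rw [hρK x hx, hρK _ (K.deriv_mem hx)]
        rfl
      · obtain rfl : x = ⟨c, hcE⟩ := Subtype.ext hx
        change ρ ((⟨c, hcE⟩ : E)′) = ((ρ ⟨c, hcE⟩)′)
        have : ((⟨c, hcE⟩ : E)′) = 0 := Subtype.ext hc0
        rw [this, hρc]
        simp [hc0]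
    obtain ⟨τ, hτ, hτρ⟩ := exists_differential_extend hEL (fun x hx => hya
      (fun x hx => isAlgebraic_algebraMap (⟨x, hKE hx⟩ : E)) haE x hx) ρ hρ
    have h1 := (hL.strong τ hτ (fun x hx => (hτρ ⟨x, hKE hx⟩).trans (hρK ⟨x, hKE hx⟩ hx))).1 ⟨c, hcL⟩
      ⟨hcL, hc0⟩
    rw [hτρ ⟨c, hcE⟩, hρc] at h1
    simp at h1

end DiffSubfield

/-! ### Linear disjointness from constants, and descent of relations. -/

theorem aeval_eq_sum {R B σ : Type*} [CommSemiring R] [CommSemiring B] [Algebra R B] (v : σ → B)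
    (f : MvPolynomial σ R) : MvPolynomial.aeval v f =
      ∑ m ∈ f.support, algebraMap R B (f.coeff m) * m.prod fun i n => v i ^ n := by
  rw [MvPolynomial.aeval_def, MvPolynomial.eval₂_eq]
  rfl

namespace DiffSubfield

variable {A : Type u} [Field A] [Differential A]

/-- Constants that are linearly independent over the constants of `L` are so over `L`. -/
theorem linearIndependent_of_constants {L : DiffSubfield A} {k0 : Subfield A}
    (h0 : ∀ x ∈ L, x′ = 0 → x ∈ k0) {ι : Type*} {e : ι → A} (he : ∀ i, (e i)′ = 0)
    (hli : LinearIndependent k0 e) : LinearIndependent L e := by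
  classical
  have key : ∀ (n : ℕ) (s : Finset ι), s.card = n → ∀ l : ι → A, (∀ i, l i ∈ L) →
      ∑ i ∈ s, l i * e i = 0 → ∀ i ∈ s, l i = 0 := by
    intro n
    induction n with
    | zero =>
      intro s hs l _ _ i hi
      rw [Finset.card_eq_zero.1 hs] at hi
      simp at hi
    | succ n ih =>
      intro s hs l hl hsum i₀ hi₀
      by_contra hne
      -- Normalise one coefficient to 1 and differentiate: that term disappears, and by induction
      -- the remaining derivatives vanish. The normalised coefficients are then constants of L,
      -- against independence over `k0`.
      have hm : ∑ i ∈ s, l i / l i₀ * e i = 0 := by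
        have : ∑ i ∈ s, l i / l i₀ * e i = (∑ i ∈ s, l i * e i) / l i₀ := by
          rw [Finset.sum_div]
          exact Finset.sum_congr rfl fun i _ => by ring
        rw [this, hsum, zero_div]
      have hd : ∑ i ∈ s, (l i / l i₀)′ * e i = 0 := by
        have := congrArg (fun t : A => t′) hm
        simp only [map_sum, derivation_mul, he, mul_zero, zero_add, map_zero] at this
        rw [← this]
        exact Finset.sum_congr rfl fun i _ => mul_comm _ _
      have h00 : (l i₀ / l i₀)′ = 0 := by rw [div_self hne]; simp
      rw [← Finset.add_sum_erase _ _ hi₀, h00, zero_mul, zero_add] at hd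
      have hmL (i) : l i / l i₀ ∈ L := div_mem (hl i) (hl i₀)
      have hz := ih (s.erase i₀) (by rw [Finset.card_erase_of_mem hi₀, hs]; rfl)
        (fun i => (l i / l i₀)′) (fun i => L.deriv_mem (hmL i)) hd
      have hk (i) (hi : i ∈ s) : l i / l i₀ ∈ k0 := by
        refine h0 _ (hmL i) ?_
        by_cases h : i = i₀
        · rw [h, h00]
        · exact hz i (Finset.mem_erase.2 ⟨h, hi⟩)
      have := linearIndependent_iff'.1 hli s
        (fun i => if h : l i / l i₀ ∈ k0 then ⟨l i / l i₀, h⟩ else 0) (by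
          rw [← hm]
          refine Finset.sum_congr rfl fun i hi => ?_
          rw [dif_pos (hk i hi)]
          rfl) i₀ hi₀
      rw [dif_pos (hk i₀ hi₀)] at this
      have h1 : l i₀ / l i₀ = 0 := congrArg Subtype.val this
      rw [div_self hne] at h1
      exact one_ne_zero h1
  refine linearIndependent_iff'.2 fun s g hg i hi => Subtype.ext ?_
  exact key _ s rfl (fun i => (g i : A)) (fun i => (g i).2) hg i hi

/-- A subfield `C` that contains the subfield `k`, as a vector space over `k`. -/
def _root_.Subfield.toSubmoduleOfLE {A : Type u} [Field A] {k C : Subfield A} (h : k ≤ C) :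
    Submodule k A where
  carrier := C
  add_mem' := add_mem
  zero_mem' := zero_mem C
  smul_mem' c _ hx := mul_mem (h c.2) hx

variable {K L : DiffSubfield A} {k0 C : Subfield A}

theorem exists_basis_constants (hC : ∀ x ∈ C, x′ = 0) (hkC : k0 ≤ C)
    (h0 : ∀ x ∈ L, x′ = 0 → x ∈ k0) :
    ∃ (ι : Type u) (e : ι → A), (∀ i, e i ∈ C) ∧ LinearIndependent L e ∧
      ∀ x ∈ C, ∃ l : ι →₀ k0, x = l.sum fun i c => (c : A) * e i := by
  let N := Subfield.toSubmoduleOfLE hkC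
  let b := Module.Basis.ofVectorSpace k0 N
  refine ⟨_, fun i => (b i : A), fun i => (b i).2,
    linearIndependent_of_constants h0 (fun i => hC _ (b i).2) ?_, fun x hx => ?_⟩
  · exact b.linearIndependent.map' N.subtype (Submodule.ker_subtype N)
  · refine ⟨b.repr ⟨x, hx⟩, ?_⟩
    have := congrArg N.subtype (b.linearCombination_repr ⟨x, hx⟩)
    rw [Finsupp.linearCombination_apply, map_finsuppSum] at this
    exact this.symm

/-- Elements of `L` that are linearly independent over the constants of `L` are so over every
field of constants. -/
theorem eq_zero_of_sum_constants (hC : ∀ x ∈ C, x′ = 0) (hkC : k0 ≤ C) (hkL : ∀ x ∈ k0, x ∈ L)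
    (h0 : ∀ x ∈ L, x′ = 0 → x ∈ k0) {ι : Type*} {b : ι → A} (hb : ∀ i, b i ∈ L)
    (hli : LinearIndependent k0 b) (s : Finset ι) (c : ι → A) (hc : ∀ i, c i ∈ C)
    (h : ∑ i ∈ s, c i * b i = 0) : ∀ i ∈ s, c i = 0 := by
  classical
  obtain ⟨J, e, -, heL, hspan⟩ := exists_basis_constants hC hkC h0
  choose l hl using fun i => hspan (c i) (hc i)
  let t := s.biUnion fun i => (l i).support
  have hl' (i) (hi : i ∈ s) : c i = ∑ j ∈ t, (l i j : A) * e j := by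
    rw [hl i, Finsupp.sum]
    refine Finset.sum_subset (Finset.subset_biUnion_of_mem (fun i => (l i).support) hi) ?_
    intro j _ hj
    rw [Finsupp.notMem_support_iff.1 hj]
    simp
  have hsum : ∑ j ∈ t, (∑ i ∈ s, (l i j : A) * b i) * e j = 0 := by
    rw [← h]
    simp only [Finset.sum_mul]
    rw [Finset.sum_comm]
    refine Finset.sum_congr rfl fun i hi => ?_
    rw [hl' i hi, Finset.sum_mul]
    exact Finset.sum_congr rfl fun j _ => by ring
  have hz := linearIndependent_iff'.1 heL t
    (fun j => ⟨∑ i ∈ s, (l i j : A) * b i, sum_mem fun i _ => mul_mem (hkL _ (l i j).2) (hb i)⟩) hsum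
  intro i hi
  have hz' (j) (hj : j ∈ t) : l i j = 0 :=
    linearIndependent_iff'.1 hli s (fun i => l i j) (congrArg Subtype.val (hz j hj)) i hi
  rw [hl' i hi]
  exact Finset.sum_eq_zero fun j hj => by simp [hz' j hj]

/-- Polynomial relations over `L` between constants are generated by relations over the
constants of `L`. -/
theorem exists_finset_constants (hC : ∀ x ∈ C, x′ = 0) (hkC : k0 ≤ C) (hkL : ∀ x ∈ k0, x ∈ L)
    (h0 : ∀ x ∈ L, x′ = 0 → x ∈ k0) {σ : Type*} (P : MvPolynomial σ L) :
    ∃ G : Finset (MvPolynomial σ k0), ∀ v : σ → A, (∀ i, v i ∈ C) →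
      (MvPolynomial.aeval v P = 0 ↔ ∀ g ∈ G, MvPolynomial.aeval v g = 0) := by
  classical
  let N : Submodule k0 A := Subfield.toSubmoduleOfLE (k := k0) (C := L.toSubfield) hkL
  -- Expanding the coefficients of P in a basis of L over `k0` gives P = ∑ b_j g_j with g_j over
  -- `k0`. At constant arguments the values g_j(v) are constants, so P(v) = 0 forces each to vanish.
  let b := Module.Basis.ofVectorSpace k0 N
  have hb : LinearIndependent k0 fun j => (b j : A) :=
    b.linearIndependent.map' N.subtype (Submodule.ker_subtype N)
  let l (m : σ →₀ ℕ) := b.repr (⟨(P.coeff m : L), (P.coeff m).2⟩ : N)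
  let t := P.support.biUnion fun m => (l m).support
  have hl (m) (hm : m ∈ P.support) : ((P.coeff m : L) : A) = ∑ j ∈ t, (l m j : A) * b j := by
    have := congrArg N.subtype (b.linearCombination_repr (⟨(P.coeff m : L), (P.coeff m).2⟩ : N))
    rw [Finsupp.linearCombination_apply, map_finsuppSum] at this
    refine this.symm.trans ?_
    refine Finset.sum_subset (Finset.subset_biUnion_of_mem (fun m => (l m).support) hm) ?_
    intro j _ hj
    have : l m j = 0 := Finsupp.notMem_support_iff.1 hj
    change N.subtype (l m j • b j) = 0
    rw [this, zero_smul, map_zero]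
  let g (j) : MvPolynomial σ k0 := ∑ m ∈ P.support, MvPolynomial.monomial m (l m j)
  have hg (v : σ → A) (j) : MvPolynomial.aeval v (g j) =
      ∑ m ∈ P.support, (l m j : A) * m.prod fun i n => v i ^ n := by
    simp only [g, map_sum, MvPolynomial.aeval_monomial]
    rfl
  have hP (v : σ → A) : MvPolynomial.aeval v P = ∑ j ∈ t, MvPolynomial.aeval v (g j) * b j := by
    simp only [hg, Finset.sum_mul]
    rw [aeval_eq_sum, Finset.sum_comm]
    refine Finset.sum_congr rfl fun m hm => ?_
    rw [show algebraMap L A (P.coeff m) = _ from hl m hm, Finset.sum_mul]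
    exact Finset.sum_congr rfl fun j _ => by ring
  refine ⟨t.image g, fun v hv => ?_⟩
  rw [Finset.forall_mem_image, hP]
  refine ⟨fun h => ?_, fun h => Finset.sum_eq_zero fun j hj => by rw [h hj, zero_mul]⟩
  have := eq_zero_of_sum_constants hC hkC hkL h0 (fun j => (b j).2) hb t
    (fun j => MvPolynomial.aeval v (g j)) (fun j => ?_) h
  · exact fun j hj => this j hj
  · rw [hg]
    exact sum_mem fun m _ => mul_mem (hkC (l m j).2) (prod_mem fun i _ => pow_mem (hv i) _)

/-- The coefficients in L have been traded for coefficients in `k0`, so the zero set is definable in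
the pure field C. -/
theorem definable_aeval_eq_zero (hC : ∀ x ∈ C, x′ = 0) (hkC : k0 ≤ C) (hkL : ∀ x ∈ k0, x ∈ L)
    (h0 : ∀ x ∈ L, x′ = 0 → x ∈ k0) {σ : Type*} (P : MvPolynomial σ L) :
    letI := FirstOrder.Ring.compatibleRingOfRing C
    {c : C | (c : A) ∈ k0}.Definable FirstOrder.Language.ring
      {v : σ → C | MvPolynomial.aeval (fun i => (v i : A)) P = 0} := by
  classical
  let := FirstOrder.Ring.compatibleRingOfRing C
  obtain ⟨G, hG⟩ := exists_finset_constants hC hkC hkL h0 P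
  let i : k0 →+* C := Subring.inclusion (R := A) (S := k0.toSubring) (T := C.toSubring) hkC
  have h := FirstOrder.Ring.mvPolynomial_zeroLocus_definable (G.image (MvPolynomial.map i))
  have hB : (⋃ p ∈ G.image (MvPolynomial.map (σ := σ) i),
      (fun m => MvPolynomial.coeff m p) '' (p.support : Set (σ →₀ ℕ))) ⊆ {c : C | (c : A) ∈ k0} := by
    intro c hc
    simp only [Set.mem_iUnion, Finset.mem_image] at hc
    obtain ⟨_, ⟨p, -, rfl⟩, m, -, rfl⟩ := hc
    change ((MvPolynomial.coeff m (MvPolynomial.map i p) : C) : A) ∈ k0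
    rw [MvPolynomial.coeff_map]
    exact (p.coeff m).2
  convert h.mono hB
  ext v
  rw [Set.mem_ofPred_eq, hG _ fun i => (v i).2, MvPolynomial.zeroLocus_span]
  have hev (g : MvPolynomial σ k0) : MvPolynomial.aeval (fun i => (v i : A)) g =
      (MvPolynomial.aeval v (MvPolynomial.map i g) : C) := by
    rw [aeval_eq_sum, MvPolynomial.aeval_def, MvPolynomial.eval₂_map, MvPolynomial.eval₂_eq,
      AddSubmonoidClass.coe_finsetSum]
    refine Finset.sum_congr rfl fun m _ => ?_
    rw [MulMemClass.coe_mul, SubmonoidClass.coe_finsetProd]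
    rfl
  simp [hev]

/-- Relations over `K(C)` between elements of `L` are consequences of those over `K`. -/
theorem aeval_eq_zero_of_adjoin_constants {F : DiffSubfield A} (hC : ∀ x ∈ C, x′ = 0)
    (hkC : k0 ≤ C) (hkK : ∀ x ∈ k0, x ∈ K) (hKL : K ≤ L)
    (h0 : ∀ x ∈ L, x′ = 0 → x ∈ k0) (hF : ∀ x ∈ F, x ∈ IntermediateField.adjoin K (C : Set A))
    {σ : Type*} {v w : σ → A} (hv : ∀ i, v i ∈ L)
    (h : ∀ f : MvPolynomial σ K, MvPolynomial.aeval v f = 0 → MvPolynomial.aeval w f = 0)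
    (f : MvPolynomial σ F) (hf : MvPolynomial.aeval v f = 0) : MvPolynomial.aeval w f = 0 := by
  classical
  obtain ⟨J, e, heC, heL, hspan⟩ := exists_basis_constants hC hkC h0
  have hadj (x) (hx : x ∈ Algebra.adjoin K (C : Set A)) :
      ∃ l : J →₀ K, x = l.sum fun i c => (c : A) * e i := by
    -- C is closed under multiplication, so K[C] is the K-span of C, hence of the basis e.
    have hxs : x ∈ Submodule.span K (Set.range e) := by
      have hx' : x ∈ (Algebra.adjoin K (C : Set A)).toSubmodule := hx
      have hcl : (Submonoid.closure (C : Set A) : Set A) = C :=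
        congrArg _ (Submonoid.closure_eq C.toSubmonoid)
      rw [Algebra.adjoin_eq_span, hcl] at hx'
      refine Submodule.span_le.2 (fun c hc => ?_) hx'
      obtain ⟨l, rfl⟩ := hspan c hc
      exact sum_mem fun i _ => Submodule.smul_mem _ (⟨l i, hkK _ (l i).2⟩ : K)
        (Submodule.subset_span ⟨i, rfl⟩)
    obtain ⟨l, hl⟩ := (Finsupp.mem_span_range_iff_exists_finsupp).1 hxs
    exact ⟨l, hl.symm⟩
  -- A common denominator d brings the coefficients of f into K[C]. Then d·f = ∑ e_j g_j with g_j
  -- over K, and independence of the e_j over L gives g_j(v) = 0 for each j.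
  have hden (s : Finset (σ →₀ ℕ)) : ∃ d : A, d ≠ 0 ∧
      d ∈ Algebra.adjoin K (C : Set A) ∧ ∀ m ∈ s, d * (f.coeff m : F) ∈ Algebra.adjoin K (C : Set A) := by
    induction s using Finset.induction_on with
    | empty => exact ⟨1, one_ne_zero, by simp⟩
    | insert m s hm ih =>
      obtain ⟨d, hd0, hdR, hd⟩ := ih
      obtain ⟨r, hr, u, hu, e⟩ := IntermediateField.mem_adjoin_iff_div.1 (hF _ (f.coeff m).2)
      by_cases hu0 : u = 0
      · refine ⟨d, hd0, hdR, fun n hn => ?_⟩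
        rcases Finset.mem_insert.1 hn with rfl | hn
        · rw [e, hu0, div_zero, mul_zero]
          exact zero_mem _
        · exact hd n hn
      · refine ⟨d * u, mul_ne_zero hd0 hu0, mul_mem hdR hu, fun n hn => ?_⟩
        rcases Finset.mem_insert.1 hn with rfl | hn
        · rw [e, mul_assoc, mul_div_cancel₀ _ hu0]
          exact mul_mem hdR hr
        · rw [mul_right_comm]
          exact mul_mem (hd n hn) hu
  obtain ⟨d, hd0, -, hd⟩ := hden f.support
  have hl' (m : σ →₀ ℕ) : ∃ l : J →₀ K, m ∈ f.support → 
      d * (f.coeff m : F) = l.sum fun i c => (c : A) * e i := by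
    by_cases hm : m ∈ f.support
    · obtain ⟨l, hl⟩ := hadj _ (hd m hm)
      exact ⟨l, fun _ => hl⟩
    · exact ⟨0, fun h => absurd h hm⟩
  choose l hl using hl'
  let t := f.support.biUnion fun m => (l m).support
  let g (j) : MvPolynomial σ K := ∑ m ∈ f.support, MvPolynomial.monomial m (l m j)
  have hfg (v : σ → A) : d * MvPolynomial.aeval v f = ∑ j ∈ t, MvPolynomial.aeval v (g j) * e j := by
    have hg (j) : MvPolynomial.aeval v (g j) =
        ∑ m ∈ f.support, (l m j : A) * m.prod fun i n => v i ^ n := by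
      simp only [g, map_sum, MvPolynomial.aeval_monomial]
      rfl
    simp only [hg, Finset.sum_mul]
    rw [aeval_eq_sum, Finset.sum_comm, Finset.mul_sum]
    refine Finset.sum_congr rfl fun m hm => ?_
    have hlm : d * algebraMap F A (f.coeff m) = ∑ j ∈ t, (l m j : A) * e j := by
      refine (hl m hm).trans ?_
      refine Finset.sum_subset (Finset.subset_biUnion_of_mem (fun m => (l m).support) hm) ?_
      intro j _ hj
      rw [Finsupp.notMem_support_iff.1 hj]
      simp
    rw [← mul_assoc, hlm, Finset.sum_mul]
    exact Finset.sum_congr rfl fun j _ => by ring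
  have hz : ∀ j ∈ t, MvPolynomial.aeval v (g j) = 0 := by
    have hs := hfg v
    rw [hf, mul_zero] at hs
    have hvL (q : MvPolynomial σ K) : MvPolynomial.aeval v q ∈ L := by
      rw [aeval_eq_sum]
      exact sum_mem fun m _ => mul_mem (hKL (q.coeff m).2) (prod_mem fun i _ => pow_mem (hv i) _)
    intro j hj
    exact congrArg Subtype.val (linearIndependent_iff'.1 heL t
      (fun j => ⟨MvPolynomial.aeval v (g j), hvL _⟩) hs.symm j hj)
  have := hfg w
  rw [Finset.sum_eq_zero fun j hj => by rw [h _ (hz j hj), zero_mul]] at this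
  exact (mul_eq_zero.1 this).resolve_left hd0

end DiffSubfield

/-! ### Specialisations and the automorphisms they define. -/

/-- Two points of the curve, the first algebraic over the second, have the same relations as soon
as the relations of the first hold at the second. -/
theorem aeval_eq_zero_iff_of_imp {F : Type*} {B : Type u} [Field F] [CharZero F] [Field B]
    [Algebra F B] {g2 g3 : F} {a y b z : B}
    (ha : y ^ 2 = 4 * a ^ 3 + algebraMap F B g2 * a - algebraMap F B g3)
    (hb : z ^ 2 = 4 * b ^ 3 + algebraMap F B g2 * b - algebraMap F B g3)
    (hab : ∀ f : MvPolynomial (Fin 2) F, MvPolynomial.aeval ![a, y] f = 0 →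
      MvPolynomial.aeval ![b, z] f = 0)
    (halg : IsAlgebraic F b → IsAlgebraic F a) (f : MvPolynomial (Fin 2) F) :
    MvPolynomial.aeval ![a, y] f = 0 ↔ MvPolynomial.aeval ![b, z] f = 0 := by
  refine ⟨hab f, fun hf => ?_⟩
  by_cases haF : IsAlgebraic F a
  · have hyF : IsAlgebraic F y := by
      refine IsAlgebraic.of_pow two_pos ?_
      rw [ha]
      have h4 : IsAlgebraic F (4 : B) := by
        rw [← map_ofNat (algebraMap F B) 4]
        exact isAlgebraic_algebraMap _
      exact ((h4.mul (haF.pow 3)).add ((isAlgebraic_algebraMap g2).mul haF)).sub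
        (isAlgebraic_algebraMap g3)
    have hint : IsAlgebraic F (MvPolynomial.aeval ![a, y] f) := by
      clear hf
      induction f using MvPolynomial.induction_on with
      | C r => simpa using isAlgebraic_algebraMap r
      | add f g hf hg => simpa only [map_add] using hf.add hg
      | mul_X f i hf =>
        rw [map_mul, MvPolynomial.aeval_X]
        refine hf.mul ?_
        fin_cases i
        · exact haF
        · exact hyF
    by_contra hne
    have h0 := minpoly.coeff_zero_ne_zero hint.isIntegral hne
    have h1 := hab (Polynomial.aeval f (minpoly F (MvPolynomial.aeval ![a, y] f)))
      -- Composing f with the minimal polynomial of f(a, y) gives a relation at (a, y), hence at (b,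
      -- z). As f(b, z) = 0, its constant term would be 0.
      (by rw [← Polynomial.aeval_algHom_apply, minpoly.aeval])
    rw [← Polynomial.aeval_algHom_apply, hf, ← Polynomial.coeff_zero_eq_aeval_zero'] at h1
    exact h0 (by simpa using h1)
  · obtain ⟨p, q, h⟩ := exists_reduction g2 g3 f
    rw [h B b z hb] at hf
    obtain ⟨rfl, rfl⟩ := reduction_eq_zero hb (fun h => haF (halg h)) hf
    rw [h B a y ha]
    simp

/-- Clearing denominators in the addition law of the curve. -/
theorem exists_polynomial_add {A : Type*} [Field A] [CharZero A] {S : Type*} [SetLike S A]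
    [SubfieldClass S A] {K L : S} (hKL : ∀ x ∈ K, x ∈ L) (a y : L) (f : MvPolynomial (Fin 2) K) :
    ∃ P : MvPolynomial (Fin 2) L, ∀ z w : A, (a : A) ≠ z →
      (MvPolynomial.aeval ![(((y - w) / (2 * (a - z))) ^ 2 - a - z : A),
        -((y - w) / (a - z) * (((y - w) / (2 * (a - z))) ^ 2 - a - z - a) + y)] f = 0 ↔
      MvPolynomial.aeval ![z, w] P = 0) := by
  -- Rational functions of (z, w) over L whose denominator is a power of a - z; they are closed
  -- under sums and products.
  let Rat (Φ : A → A → A) : Prop := ∃ (P : MvPolynomial (Fin 2) L) (n : ℕ), ∀ z w : A, (a : A) ≠ z →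
    Φ z w * (a - z) ^ n = MvPolynomial.aeval ![z, w] P
  have hconst (c : L) : Rat fun _ _ => (c : A) := ⟨.C c, 0, fun z w _ => by simp; rfl⟩
  have hz : Rat fun z _ => z := ⟨.X 0, 0, fun z w _ => by simp⟩
  have hw : Rat fun _ w => w := ⟨.X 1, 0, fun z w _ => by simp⟩
  have haa : ∀ z w : A, MvPolynomial.aeval ![z, w] (.C a - .X 0 : MvPolynomial (Fin 2) L) = a - z := by
    intro z w
    simp
    rfl
  have hadd {Φ Ψ} (h : Rat Φ) (h' : Rat Ψ) : Rat fun z w => Φ z w + Ψ z w := by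
    obtain ⟨P, n, h⟩ := h
    obtain ⟨Q, m, h'⟩ := h'
    refine ⟨P * (.C a - .X 0) ^ m + Q * (.C a - .X 0) ^ n, n + m, fun z w hne => ?_⟩
    rw [map_add, map_mul, map_mul, map_pow, map_pow, haa, ← h z w hne, ← h' z w hne]
    ring
  have hmul {Φ Ψ} (h : Rat Φ) (h' : Rat Ψ) : Rat fun z w => Φ z w * Ψ z w := by
    obtain ⟨P, n, h⟩ := h
    obtain ⟨Q, m, h'⟩ := h'
    refine ⟨P * Q, n + m, fun z w hne => ?_⟩
    rw [map_mul, ← h z w hne, ← h' z w hne]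
    ring
  have hinv : Rat fun z _ => ((a : A) - z)⁻¹ := ⟨1, 1, fun z w hne => by
    have := sub_ne_zero.2 hne
    simp [this]⟩
  have hneg {Φ} (h : Rat Φ) : Rat fun z w => -Φ z w := by
    have := hmul (hconst (-1)) h
    simpa using this
  have hslope : Rat fun z w => ((y : A) - w) * (a - z)⁻¹ := by
    have := hmul (hadd (hconst y) (hneg hw)) hinv
    simpa [← sub_eq_add_neg] using this
  have hX : Rat fun z w => ((y - w) / (2 * (a - z))) ^ 2 - a - z := by
    have := hadd (hadd (hmul (hconst ⟨4⁻¹, inv_mem (ofNat_mem L 4)⟩) (hmul hslope hslope)) (hconst (-a))) (hneg hz)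
    convert this using 3 with z w
    simp only [div_eq_mul_inv, mul_inv]
    push_cast
    ring
  have hY : Rat fun z w => -((y - w) / (a - z) * (((y - w) / (2 * (a - z))) ^ 2 - a - z - a) + y) := by
    have := hneg (hadd (hmul hslope (hadd hX (hconst (-a)))) (hconst y))
    convert this using 3 with z w
    simp only [div_eq_mul_inv, mul_inv]
    push_cast
    ring
  have hf : Rat fun z w => MvPolynomial.aeval ![(((y - w) / (2 * (a - z))) ^ 2 - a - z : A),
      -((y - w) / (a - z) * (((y - w) / (2 * (a - z))) ^ 2 - a - z - a) + y)] f := by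
    induction f using MvPolynomial.induction_on with
    | C r =>
      simp only [MvPolynomial.aeval_C]
      exact hconst ⟨r, hKL r r.2⟩
    | add f g hf hg => simpa only [map_add] using hadd hf hg
    | mul_X f i hf =>
      fin_cases i
      · simpa using hmul hf hX
      · simpa using hmul hf hY
  obtain ⟨P, n, h⟩ := hf
  refine ⟨P, fun z w hne => ?_⟩
  rw [← h z w hne, mul_eq_zero, or_iff_left (pow_ne_zero _ (sub_ne_zero.2 hne))]

namespace Weierstrass

variable {A : Type*} [Field A] [CharZero A] {g2 g3 : A}

theorem rationalPoints_mono {E F : Subfield A} {h2 : g2 ∈ F} {h3 : g3 ∈ F} {R : Pt g2 g3}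
    (hR : R ∈ rationalPoints F h2 h3) (hE : ∀ x ∈ F, x ∈ E) :
    R ∈ rationalPoints E (hE _ h2) (hE _ h3) := by
  rcases hR with h | ⟨x, hx, w, hw, h⟩
  · exact Or.inl h
  · exact Or.inr ⟨x, hE x hx, w, hE w hw, h⟩

theorem HasCoords.mem_of_mem_rationalPoints {E : Subfield A} {h2 : g2 ∈ E} {h3 : g3 ∈ E}
    {P : Pt g2 g3} {x w : A} (hP : HasCoords P x w) (h : P ∈ rationalPoints E h2 h3) :
    x ∈ E ∧ w ∈ E := by
  rcases h with h | ⟨x', hx, w', hw, h⟩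
  · subst h
    exact absurd hP not_hasCoords_zero
  · obtain ⟨rfl, rfl⟩ := hP.unique h
    exact ⟨hx, hw⟩

end Weierstrass

namespace DiffSubfield

variable {A : Type u} [Field A] [CharZero A] [Differential A]

-- A specialisation Q ↦ Q ⊕ R over F with R rational over F is invertible by subtracting R. This
-- makes it generic, hence injective, and also surjective on M; b′ = kz makes it differential.
open Classical in
theorem exists_diffAut {F M : DiffSubfield A} {k g2 g3 : A} (hk : k ∈ F)
    (hk0 : k ≠ 0) (hg2 : g2 ∈ constants F) (hg3 : g3 ∈ constants F) (hFM : F ≤ M)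
    {a : M} {y : A} (hM : M = gen ((F : Set A) ∪ {(a : A)}))
    (hy : y ^ 2 = 4 * (a : A) ^ 3 + g2 * a - g3) (hay : (a : A)′ = k * y)
    {Q R : Pt g2 g3} {b z : A} (hQ : HasCoords Q a y) (hb : HasCoords (Q + R) b z)
    (hR : R ∈ rationalPoints F.toSubfield hg2.1 hg3.1) (hbz : b′ = k * z)
    (hQR : ∀ f : MvPolynomial (Fin 2) F, MvPolynomial.aeval ![(a : A), y] f = 0 →
      MvPolynomial.aeval ![b, z] f = 0) :
    ∃ σ ∈ diffAut F M, (σ a : A) = b := by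
  have hMc {x : A} : x ∈ M ↔ x ∈ Subfield.closure ((F : Set A) ∪ {(a : A), y}) := by
    refine Iff.trans ?_ (mem_gen_iff_mem_closure_pair hk hk0 hg2 hg3 hy hay)
    rw [← hM]
  have hFM' {x : A} (hx : x ∈ F) : x ∈ M := hFM hx
  have hyM : y ∈ M := hMc.2 (Subfield.subset_closure (by simp))
  have hback {E : Subfield A} (hE : ∀ x ∈ F, x ∈ E) (hbE : b ∈ E) (hzE : z ∈ E) :
      (a : A) ∈ E ∧ y ∈ E := by
    refine hQ.mem_of_mem_rationalPoints (h2 := hE _ hg2.1) (h3 := hE _ hg3.1) ?_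
    have := sub_mem (show Q + R ∈ rationalPoints E (hE _ hg2.1) (hE _ hg3.1) from
      Or.inr ⟨b, hbE, z, hzE, hb⟩) (rationalPoints_mono hR hE)
    rwa [add_sub_cancel_right] at this
  have hbM : b ∈ M.toSubfield ∧ z ∈ M.toSubfield := by
    refine hb.mem_of_mem_rationalPoints (h2 := hFM hg2.1) (h3 := hFM hg3.1) (add_mem ?_ (rationalPoints_mono hR fun x => hFM'))
    exact Or.inr ⟨a, a.2, y, hyM, hQ⟩
  have hF : ∀ x ∈ F, IsAlgebraic F x := fun x hx => isAlgebraic_algebraMap (⟨x, hx⟩ : F)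
  have halg (hbF : IsAlgebraic F b) : IsAlgebraic F (a : A) := by
    have hbS : b ∈ Subfield.closure ((F : Set A) ∪ {b, z}) :=
      Subfield.subset_closure (Set.mem_union_right _ (Set.mem_insert _ _))
    have hzS : z ∈ Subfield.closure ((F : Set A) ∪ {b, z}) :=
      Subfield.subset_closure (Set.mem_union_right _ (Set.mem_insert_of_mem _ rfl))
    refine isAlgebraic_of_mem_closure (S := (F : Set A) ∪ {b, z}) ?_
      (hback (fun x hx => Subfield.subset_closure (Or.inl hx)) hbS hzS).1
    rintro s (hs | rfl | rfl)
    · exact hF s hs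
    · exact hbF
    · refine IsAlgebraic.of_pow two_pos ?_
      rw [hb.equation]
      exact (((hF 4 (ofNat_mem F 4)).mul (hbF.pow 3)).add ((hF _ hg2.1).mul hbF)).sub
        (hF _ hg3.1)
  have hiff := aeval_eq_zero_iff_of_imp (F := F) (g2 := ⟨g2, hg2.1⟩) (g3 := ⟨g3, hg3.1⟩) hy
    hb.equation hQR halg
  obtain ⟨τ', hτF', hτ'⟩ := exists_algHom_adjoin_range (F := F) ![(a : A), y] ![b, z] hiff
  obtain ⟨τ, hτF, hτa, hτy⟩ : ∃ τ : M →+* A, (∀ x : M, (x : A) ∈ F → τ x = x) ∧ τ a = b ∧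
      τ ⟨y, hyM⟩ = z := by
    have hmem (x : M) : M.toSubfield.subtype x ∈
        (IntermediateField.adjoin F (Set.range ![(a : A), y])).toSubring := by
      have hr : ({(a : A), y} : Set A) = Set.range ![(a : A), y] := by simp [Set.pair_comm]
      change _ ∈ IntermediateField.adjoin F _
      rw [← hr, mem_adjoin_iff_mem_closure]
      exact hMc.1 x.2
    exact ⟨τ'.comp (M.toSubfield.subtype.codRestrict _ hmem), fun x hx => hτF' ⟨x, hx⟩, hτ' 0, hτ' 1⟩
  have hgen {E : Subfield M} (hF : ∀ x : M, (x : A) ∈ F → x ∈ E) (ha : a ∈ E)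
      (hyE : (⟨y, hyM⟩ : M) ∈ E) (x : M) : x ∈ E := by
    refine le_subfield_of_mem_closure (fun x => hMc.1) E ?_
      (fun x hx => hMc.2 (Subfield.subset_closure hx)) x
    rintro x (hx | hx | hx)
    · exact hF x hx
    · obtain rfl : x = a := Subtype.ext hx
      exact ha
    · obtain rfl : x = ⟨y, hyM⟩ := Subtype.ext hx
      exact hyE
  have hτM (x : M) : τ x ∈ M :=
    hgen (E := M.toSubfield.comap τ) (fun x hx => by
      change τ x ∈ M
      rw [hτF x hx]
      exact x.2) (by change τ a ∈ M; rw [hτa]; exact hbM.1)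
      (by change τ _ ∈ M; rw [hτy]; exact hbM.2) x
  have hτd (x : M) : τ (x′) = (τ x)′ := by
    have hkM : k ∈ M := hFM hk
    have hg2M : g2 ∈ M := hFM hg2.1
    have hya : a′ = ⟨k, hkM⟩ * ⟨y, hyM⟩ := Subtype.ext hay
    refine hgen (E := derivEqLocus τ) (fun x hx => ?_) ?_ ?_ x
    · change τ (x′) = ((τ x)′)
      rw [hτF x hx, hτF _ (F.deriv_mem hx)]
      rfl
    · change τ (a′) = ((τ a)′)
      rw [hya, map_mul, hτF _ hk, hτa, hτy, hbz]
    · change τ ((⟨y, hyM⟩ : M)′) = ((τ ⟨y, hyM⟩)′)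
      -- The formula for y′ comes from dividing by y, so y = 0 is treated apart.
      by_cases hy0 : y = 0
      · have h0 : (⟨y, hyM⟩ : M) = 0 := Subtype.ext hy0
        simp [h0]
      · have hz0 : z ≠ 0 := by
          rw [← hτy, Ne, map_eq_zero]
          exact fun h => hy0 (congrArg Subtype.val h)
        have hy' : (⟨y, hyM⟩ : M)′ = ⟨k, hkM⟩ * (6 * a ^ 2 + ⟨g2, hg2M⟩ / 2) :=
          Subtype.ext (deriv_curve hg2.2 hg3.2 hy hay hy0)
        rw [hy', hτy, deriv_curve hg2.2 hg3.2 hb.equation hbz hz0]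
        simp only [map_mul, map_add, map_pow, map_div₀, map_ofNat, hτF ⟨k, hkM⟩ hk, hτa,
          hτF ⟨g2, hg2M⟩ hg2.1]
  have hsurj (x : M) : ∃ w, τ w = x := by
    have hE : ∀ x ∈ F, x ∈ τ.fieldRange := fun x hx => ⟨⟨x, hFM hx⟩, hτF ⟨x, hFM hx⟩ hx⟩
    have hay' := hback hE ⟨a, hτa⟩ ⟨_, hτy⟩
    refine (Subfield.closure_le (t := τ.fieldRange)).2 ?_ (hMc.1 x.2)
    rintro s (hs | rfl | rfl)
    · exact hE s hs
    · exact hay'.1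
    · exact hay'.2
  let τM : M →+* M := τ.codRestrict M.toSubfield.toSubring hτM
  have hbij : Function.Bijective τM := ⟨τM.injective, fun x => by
    obtain ⟨w, hw⟩ := hsurj x
    exact ⟨w, Subtype.ext hw⟩⟩
  refine ⟨RingEquiv.ofBijective τM hbij, ⟨fun x => Subtype.ext (hτd x), fun x hx => ?_⟩, hτa⟩
  exact Subtype.ext (hτF x hx)

end DiffSubfield

/-! ### The Galois group as a group of constant points. -/

namespace DiffSubfield

variable {A : Type u} [Field A] [CharZero A] [Differential A]

theorem _root_.Weierstrass.HasCoords.hasLogDeriv {g2 g3 k x : A} {P : Pt g2 g3} (hg2 : g2′ = 0)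
    (hg3 : g3′ = 0) (hk : k ≠ 0) (hx : x′ ≠ 0) (hP : HasCoords P x (x′ / k)) : HasLogDeriv k P := by
  have e : x′ = k * (x′ / k) := by field_simp
  exact Or.inr ⟨x, _, hP, e, deriv_curve hg2 hg3 hP.equation e (div_ne_zero hx hk)⟩

/-- Data of a Weierstrass extension `M` of `F` without new constants. -/
structure WeierstrassExtension (F M : DiffSubfield A) (C : Subfield A) (k g2 g3 : A) (a : M) :
    Prop where
  le : F ≤ M
  mem_constants : ∀ x, x ∈ C ↔ x ∈ F ∧ x′ = 0
  no_new_constants : ∀ x ∈ M, x′ = 0 → x ∈ C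
  mem_k : k ∈ F
  k_ne_zero : k ≠ 0
  disc : g2 ^ 3 + 27 * g3 ^ 2 ≠ 0
  gen_eq : M = gen ((F : Set A) ∪ {(a : A)})
  equation : ((a : A)′ / k) ^ 2 = 4 * (a : A) ^ 3 + g2 * a - g3

namespace WeierstrassExtension

variable {F M : DiffSubfield A} {C : Subfield A} {k g2 g3 : A} {a : M}

omit [CharZero A] in
theorem deriv_eq (h : WeierstrassExtension F M C k g2 g3 a) : (a : A)′ = k * ((a : A)′ / k) := by
  have := h.k_ne_zero
  field_simp

theorem mem_iff (h : WeierstrassExtension F M C k g2 g3 a) (h2 : g2 ∈ C) (h3 : g3 ∈ C) {x : A} :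
    x ∈ M ↔ x ∈ Subfield.closure ((F : Set A) ∪ {(a : A), (a : A)′ / k}) := by
  refine Iff.trans ?_ (mem_gen_iff_mem_closure_pair h.mem_k h.k_ne_zero
    ((h.mem_constants _).1 h2) ((h.mem_constants _).1 h3) h.equation h.deriv_eq)
  rw [← h.gen_eq]

open Classical in
/-- The difference of the images of the generic point is constant. -/
theorem sub_mem_rationalPoints (h : WeierstrassExtension F M C k g2 g3 a) (h2 : g2 ∈ C)
    (h3 : g3 ∈ C) {σ : M ≃+* M} (hσ : σ ∈ diffAut F M) {P Q : Pt g2 g3}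
    (hP : HasCoords P (σ a : A) ((σ a : A)′ / k)) (hQ : HasCoords Q (a : A) ((a : A)′ / k)) :
    P - Q ∈ rationalPoints C h2 h3 := by
  by_cases ha0 : (a : A)′ = 0
  · have haF : (a : A) ∈ F := ((h.mem_constants _).1 (h.no_new_constants _ a.2 ha0)).1
    rw [hσ.2 a haF] at hP
    rw [hP.eq hQ, sub_self]
    exact zero_mem _
  · have hkey {τ : M ≃+* M} (hτ : τ ∈ diffAut F M) {P : Pt g2 g3}
        (hP : HasCoords P (τ a : A) ((τ a : A)′ / k)) : HasLogDeriv k P := by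
      have h0 : (τ a : A)′ ≠ 0 := fun h0 => ha0 (by
        have : τ (a′) = 0 := (hτ.1 a).trans (Subtype.ext h0)
        exact congrArg Subtype.val ((map_eq_zero_iff τ τ.injective).1 this))
      exact hP.hasLogDeriv ((h.mem_constants _).1 h2).2 ((h.mem_constants _).1 h3).2
        h.k_ne_zero h0
    -- The logarithmic derivative of P ⊖ Q is k - k = 0. P ⊖ Q is M-rational, so its affine
    -- coordinates, if any, are constants of M.
    have hd := (hkey hσ hP).add ((h.mem_constants _).1 h2).2 (hkey (one_mem _) hQ).neg
    rw [add_neg_cancel, ← sub_eq_add_neg] at hd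
    have hk (x : A) (hx : x ∈ C) : x ∈ M := h.le ((h.mem_constants _).1 hx).1
    have hM (x : M) : (x : A)′ / k ∈ M.toSubfield := div_mem (M.deriv_mem x.2) (h.le h.mem_k)
    have hmem : P - Q ∈ rationalPoints M.toSubfield (hk _ h2) (hk _ h3) :=
      sub_mem (Or.inr ⟨_, (σ a).2, _, hM _, hP⟩) (Or.inr ⟨_, a.2, _, hM _, hQ⟩)
    rcases hd with ⟨h0, -⟩ | ⟨x, y, hxy, hx, hy⟩
    · exact Or.inl h0
    · obtain ⟨hxM, hyM⟩ := hxy.mem_of_mem_rationalPoints hmem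
      exact Or.inr ⟨x, h.no_new_constants x hxM (by rw [hx, zero_mul]), y,
        h.no_new_constants y hyM (by rw [hy, zero_mul]), hxy⟩

-- R_τ has coordinates in C ⊆ F, so σ fixes it and the cocycle σ ↦ σ(Q) ⊖ Q is a homomorphism. `φ σ`
-- is the action of σ on M-points, followed by the inclusion into the A-points.
open Classical in
theorem exists_hom (h : WeierstrassExtension F M C k g2 g3 a) (h2 : g2 ∈ C) (h3 : g3 ∈ C) :
    ∃ μ : diffAut F M →* Multiplicative (rationalPoints C h2 h3),
      (∀ σ, IsShift k a σ.1 (μ σ).toAdd.1) ∧ Function.Injective μ := by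
  have hCF (x : A) (hx : x ∈ C) : x ∈ F := ((h.mem_constants _).1 hx).1
  have hCM (x : A) (hx : x ∈ C) : x ∈ M := h.le (hCF x hx)
  let g2M : M := ⟨g2, hCM _ h2⟩
  let g3M : M := ⟨g3, hCM _ h3⟩
  let kM : M := ⟨k, h.le h.mem_k⟩
  let i : M →+* A := M.toSubfield.subtype
  have hfix (σ : diffAut F M) (x : A) (hx : x ∈ F) : i (σ.1 ⟨x, h.le hx⟩) = x :=
    congrArg Subtype.val (σ.2.2 ⟨x, h.le hx⟩ hx)
  have hφ (σ : diffAut F M) := exists_mapPt (i.comp σ.1.toRingHom) (g2 := g2M) (g3 := g3M)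
    (hfix σ _ (hCF _ h2)) (hfix σ _ (hCF _ h3))
  choose φ hφ using hφ
  have hdisc : g2M ^ 3 + 27 * g3M ^ 2 ≠ 0 := fun h0 => h.disc (congrArg Subtype.val h0)
  obtain ⟨Q, hQ⟩ := (exists_hasCoords_iff hdisc a (a′ / kM)).2 (Subtype.ext h.equation)
  have hφQ (σ : diffAut F M) : HasCoords (φ σ Q) (σ.1 a : A) ((σ.1 a : A)′ / k) := by
    have : σ.1 (a′ / kM) = (σ.1 a)′ / kM := by rw [map_div₀, σ.2.1, σ.2.2 kM h.mem_k]
    exact (hφ σ Q _ _ hQ).of_eq rfl (congrArg Subtype.val this)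
  have hφ1 : HasCoords (φ 1 Q) (a : A) ((a : A)′ / k) := hφQ 1
  have hδ (σ : diffAut F M) : φ σ Q - φ 1 Q ∈ rationalPoints C h2 h3 :=
    h.sub_mem_rationalPoints h2 h3 σ.2 (hφQ σ) hφ1
  have hR {R : Pt g2 g3} (hR : R ∈ rationalPoints C h2 h3) : ∃ R' : Pt g2M g3M, ∀ σ, φ σ R' = R := by
    rcases hR with rfl | ⟨x, hx, y, hy, hxy⟩
    · exact ⟨0, fun σ => map_zero _⟩
    · obtain ⟨R', hR'⟩ := (exists_hasCoords_iff hdisc ⟨x, hCM x hx⟩ ⟨y, hCM y hy⟩).2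
        (Subtype.ext hxy.equation)
      refine ⟨R', fun σ => ?_⟩
      have := hφ σ _ _ _ hR'
      exact (this.of_eq (hfix σ x (hCF x hx)) (hfix σ y (hCF y hy))).eq hxy
  have hcomp (σ τ : diffAut F M) {N : Pt g2M g3M} (hN : φ 1 N = φ τ Q) :
      φ σ N = φ (σ * τ) Q := by
    have hN0 : N ≠ 0 := by
      rintro rfl
      rw [map_zero] at hN
      exact not_hasCoords_zero (hN ▸ hφQ τ)
    obtain ⟨x, y, hxy⟩ := exists_hasCoords hN0
    have h1 := (hN ▸ hφ 1 N _ _ hxy).unique (hφQ τ)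
    obtain rfl : x = τ.1 a := Subtype.ext h1.1
    obtain rfl : y = (τ.1 a)′ / kM := Subtype.ext h1.2
    have : σ.1 ((τ.1 a)′ / kM) = (σ.1 (τ.1 a))′ / kM := by
      rw [map_div₀, σ.2.1, σ.2.2 kM h.mem_k]
    exact ((hφ σ N _ _ hxy).of_eq rfl (congrArg Subtype.val this)).eq (hφQ (σ * τ))
  have hmul (σ τ : diffAut F M) : φ (σ * τ) Q - φ 1 Q = (φ σ Q - φ 1 Q) + (φ τ Q - φ 1 Q) := by
    obtain ⟨R', hR'⟩ := hR (hδ τ)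
    rw [← hcomp σ τ (N := Q + R') (by rw [map_add, hR']; abel), map_add, hR' σ]
    abel
  refine ⟨MonoidHom.mk' (fun σ => Multiplicative.ofAdd ⟨φ σ Q - φ 1 Q, hδ σ⟩) fun σ τ => ?_,
    fun σ => ?_, fun σ τ e => ?_⟩
  · exact congrArg Multiplicative.ofAdd (Subtype.ext (hmul σ τ))
  · exact ⟨φ σ Q, φ 1 Q, hφQ σ, hφ1, rfl⟩
  · have e' : φ σ Q - φ 1 Q = φ τ Q - φ 1 Q :=
      congrArg (fun z => (Multiplicative.toAdd z).1) e
    have e1 : σ.1 a = τ.1 a := Subtype.ext ((hφQ σ).unique (sub_left_inj.1 e' ▸ hφQ τ)).1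
    have hall (x : M) : σ.1 x = τ.1 x := by
      refine le_subfield_of_mem_closure (fun x => (h.mem_iff h2 h3).1)
        (RingHom.eqLocusField σ.1.toRingHom τ.1.toRingHom) ?_
        (fun x hx => (h.mem_iff h2 h3).2 (Subfield.subset_closure hx)) x
      rintro x (hx | hx | hx)
      · exact (σ.2.2 x hx).trans (τ.2.2 x hx).symm
      · obtain rfl : x = a := Subtype.ext hx
        exact e1
      · obtain rfl : x = a′ / kM := Subtype.ext hx
        change σ.1 (a′ / kM) = τ.1 (a′ / kM)
        rw [map_div₀, map_div₀, σ.2.1, τ.2.1, e1, σ.2.2 kM h.mem_k, τ.2.2 kM h.mem_k]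
    exact Subtype.ext (RingEquiv.ext hall)

open Classical in
/-- The image of the group of differential automorphisms, as a set of points. -/
theorem definableIn_shift {K L : DiffSubfield A} (h : WeierstrassExtension F M C k g2 g3 a)
    (h2 : g2 ∈ C) (h3 : g3 ∈ C) (h2K : g2 ∈ K) (h3K : g3 ∈ K) (hk : k ∈ K) (hKF : K ≤ F)
    (hLK : L = gen ((K : Set A) ∪ {(a : A)})) (hLc : ∀ x ∈ L, x′ = 0 → x ∈ K)
    (hF : ∀ x ∈ F, x ∈ IntermediateField.adjoin K (C : Set A)) :
    DefinableIn C {c | (c : A) ∈ K} {R : Pt g2 g3 | ∃ σ ∈ diffAut F M, IsShift k a σ R} := by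
  have hg2 := (h.mem_constants _).1 h2
  have hg3 := (h.mem_constants _).1 h3
  have hk0 := h.k_ne_zero
  have hd := h.deriv_eq
  -- Here a lies in F, so every shift is the point at infinity and there are no affine coordinates.
  by_cases ha0 : (a : A)′ = 0
  · have haF : (a : A) ∈ F := ((h.mem_constants _).1 (h.no_new_constants _ a.2 ha0)).1
    unfold DefinableIn
    convert Set.definable_empty
    refine Set.eq_empty_of_forall_notMem ?_
    rintro v ⟨R, ⟨σ, hσ, P, Q, hP, hQ, rfl⟩, hR⟩
    rw [hσ.2 a haF] at hP
    rw [hP.eq hQ, sub_self] at hR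
    exact not_hasCoords_zero hR
  have hKL : K ≤ L := fun x hx => hLK ▸ subset_gen _ (Or.inl hx)
  have haL : (a : A) ∈ L := by
    have : (a : A) ∈ gen ((K : Set A) ∪ {(a : A)}) := subset_gen _ (by simp)
    rwa [← hLK] at this
  have hyL : (a : A)′ / k ∈ L := div_mem (L.deriv_mem haL) (hKL hk)
  obtain ⟨Q, hQ⟩ := (exists_hasCoords_iff h.disc (a : A) ((a : A)′ / k)).2 h.equation
  -- Finitely many generators of the ideal of relations of Q over K; `Pf f` expresses f(Q ⊕ R) = 0
  -- in the coordinates of R.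
  obtain ⟨T, hT⟩ := IsNoetherian.noetherian
    (RingHom.ker (MvPolynomial.aeval (R := K) ![(a : A), (a : A)′ / k]))
  choose Pf hPf using exists_polynomial_add hKL ⟨a, haL⟩ ⟨_, hyL⟩
  let W : MvPolynomial (Fin 2) L :=
    .X 1 ^ 2 - (4 * .X 0 ^ 3 + .C ⟨g2, hKL h2K⟩ * .X 0 - .C ⟨g3, hKL h3K⟩)
  have hCc (x) (hx : x ∈ C) : x′ = 0 := ((h.mem_constants _).1 hx).2
  have hkC : constants K ≤ C := fun x hx => (h.mem_constants _).2 ⟨hKF hx.1, hx.2⟩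
  have hdef (P : MvPolynomial (Fin 2) L) := definable_aeval_eq_zero (k0 := constants K) hCc hkC
    (fun x hx => hKL hx.1) (fun x hx h0 => ⟨hLc x hx h0, h0⟩) P
  have hB : {c : C | (c : A) ∈ constants K} ⊆ {c : C | (c : A) ∈ K} := fun c hc => hc.1
  unfold DefinableIn
  let := FirstOrder.Ring.compatibleRingOfRing C
  have hall := ((hdef W).inter (Set.definable_biInter_finset (fun f => hdef (Pf f)) T)).mono hB
  convert hall
  ext v
  -- a is not constant while the coordinates of R are, so the chord formula always computes Q ⊕ R.
  have hne : (a : A) ≠ v 0 := fun e => ha0 (by rw [e]; exact hCc _ (v 0).2)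
  have hv : (fun i => (v i : A)) = ![(v 0 : A), (v 1 : A)] := by
    ext i
    fin_cases i <;> rfl
  have hW : MvPolynomial.aeval (fun i => (v i : A)) W = 0 ↔
      (v 1 : A) ^ 2 = 4 * (v 0 : A) ^ 3 + g2 * (v 0 : A) - g3 := by
    simp [W, map_ofNat]
    exact sub_eq_zero
  have hmem : v ∈ {v : Fin 2 → C | MvPolynomial.aeval (fun i => (v i : A)) W = 0} ∩
      ⋂ f ∈ T, {v : Fin 2 → C | MvPolynomial.aeval (fun i => (v i : A)) (Pf f) = 0} ↔
      (v 1 : A) ^ 2 = 4 * (v 0 : A) ^ 3 + g2 * (v 0 : A) - g3 ∧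
      ∀ f ∈ T, MvPolynomial.aeval ![(v 0 : A), (v 1 : A)] (Pf f) = 0 := by
    rw [← hW, ← hv]
    simp
  rw [hmem]
  constructor
  · rintro ⟨R, ⟨σ, hσ, P, Q', hP, hQ', rfl⟩, hR⟩
    obtain rfl := hQ'.eq hQ
    refine ⟨hR.equation, fun f hf => ?_⟩
    rw [← hPf f _ _ hne]
    obtain ⟨e1, e2⟩ := ((hQ.add hR hne).of_eq rfl rfl).unique
      (show HasCoords (Q' + (P - Q')) _ _ by rwa [add_sub_cancel])
    have hfQ : MvPolynomial.aeval ![(a : A), (a : A)′ / k] f = 0 := by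
      have : f ∈ RingHom.ker (MvPolynomial.aeval (R := K) ![(a : A), (a : A)′ / k]) := by
        rw [← hT]
        exact Submodule.subset_span hf
      exact this
    let j : K →+* M := Subring.inclusion (R := A) (S := K.toSubring) (T := M.toSubring)
      (hKF.trans h.le)
    let v' : Fin 2 → M := ![a, ⟨(a : A)′ / k, div_mem (M.deriv_mem a.2) (h.le h.mem_k)⟩]
    let i : M →+* A := M.toSubfield.subtype
    have h0 : MvPolynomial.eval₂ j v' f = 0 := by
      apply i.injective
      rw [MvPolynomial.hom_eval₂, map_zero, ← hfQ]
      congr 1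
      ext l
      fin_cases l <;> rfl
    have h1 := congrArg (i.comp σ.toRingHom) h0
    rw [MvPolynomial.hom_eval₂, map_zero] at h1
    rw [← h1, MvPolynomial.aeval_def]
    have hσy : (i.comp σ.toRingHom) (v' 1) = (σ a : A)′ / k := by
      have : v' 1 = a′ / ⟨k, h.le h.mem_k⟩ := rfl
      have h2 : σ (v' 1) = (σ a)′ / ⟨k, h.le h.mem_k⟩ := by
        rw [this, map_div₀, hσ.1, hσ.2 ⟨k, h.le h.mem_k⟩ h.mem_k]
      exact congrArg Subtype.val h2
    congr 1
    · ext x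
      exact (congrArg Subtype.val (hσ.2 (j x) (hKF x.2))).symm
    · ext l
      fin_cases l
      · exact e1
      · exact e2.trans hσy.symm
  · rintro ⟨hcurve, hvT⟩
    obtain ⟨R, hR⟩ := (exists_hasCoords_iff h.disc (v 0 : A) (v 1 : A)).2 hcurve
    have hadd := hQ.add hR hne
    have hvF (l) : (v l : A) ∈ F := ((h.mem_constants _).1 (v l).2).1
    -- Constant points have logarithmic derivative 0; this yields b′ = kz for Q ⊕ R = (b, z).
    have hlog : HasLogDeriv (k + 0) (Q + R) :=
      (hQ.hasLogDeriv hg2.2 hg3.2 hk0 ha0).add hg2.2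
        (Or.inr ⟨_, _, hR, by simp [hCc _ (v 0).2], by simp [hCc _ (v 1).2]⟩)
    generalize hb : (((a : A)′ / k - v 1) / (2 * ((a : A) - v 0))) ^ 2 - a - v 0 = b at hadd
    generalize hz : -(((a : A)′ / k - v 1) / ((a : A) - v 0) * (b - a) + (a : A)′ / k) = z at hadd
    have hbz : b′ = k * z := by
      rcases hlog with ⟨h0, -⟩ | ⟨x, y, hxy, hx, -⟩
      · exact absurd (h0 ▸ hadd) not_hasCoords_zero
      · obtain ⟨rfl, rfl⟩ := hxy.unique hadd
        rw [hx, add_zero]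
    have hvT' (f) (hf : f ∈ T) : MvPolynomial.aeval ![b, z] f = 0 := by
      rw [← hz, ← hb]
      exact (hPf f _ _ hne).2 (hvT f hf)
    have hK (f : MvPolynomial (Fin 2) K)
        (hf : MvPolynomial.aeval ![(a : A), (a : A)′ / k] f = 0) :
        MvPolynomial.aeval ![b, z] f = 0 := by
      have hle : RingHom.ker (MvPolynomial.aeval (R := K) ![(a : A), (a : A)′ / k]) ≤
          RingHom.ker (MvPolynomial.aeval (R := K) ![b, z]) := by
        rw [← hT]
        exact Submodule.span_le.2 hvT'
      exact hle hf
    -- The conditions only test relations over K; linear disjointness gives all relations over F, as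
    -- an automorphism fixing F requires.
    have hFQ := aeval_eq_zero_of_adjoin_constants (L := L) (F := F) hCc hkC (fun x hx => hx.1) hKL
      (fun x hx h0 => ⟨hLc x hx h0, h0⟩) hF (v := ![(a : A), (a : A)′ / k]) (w := ![b, z])
      (fun l => by
        fin_cases l
        · exact haL
        · exact hyL) hK
    obtain ⟨σ, hσ, hσa⟩ := exists_diffAut h.mem_k hk0 hg2 hg3 h.le h.gen_eq h.equation hd hQ hadd
      (Or.inr ⟨_, hvF 0, _, hvF 1, hR⟩) hbz hFQ
    refine ⟨R, ⟨σ, hσ, Q + R, Q, ?_, hQ, (add_sub_cancel_left Q R).symm⟩, hR⟩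
    exact hadd.of_eq hσa.symm (by rw [hσa, hbz]; field_simp)

open Classical in
theorem exists_hom_definableIn {K L : DiffSubfield A} (h : WeierstrassExtension F M C k g2 g3 a)
    (h2 : g2 ∈ C) (h3 : g3 ∈ C) (h2K : g2 ∈ K) (h3K : g3 ∈ K) (hk : k ∈ K) (hKF : K ≤ F)
    (hLK : L = gen ((K : Set A) ∪ {(a : A)})) (hLc : ∀ x ∈ L, x′ = 0 → x ∈ K)
    (hF : ∀ x ∈ F, x ∈ IntermediateField.adjoin K (C : Set A)) :
    ∃ μ : diffAut F M →* Multiplicative (rationalPoints C h2 h3),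
      (∀ σ, IsShift k a σ.1 (μ σ).toAdd.1) ∧ Function.Injective μ ∧
      DefinableIn C {c | (c : A) ∈ K} {R : Pt g2 g3 | ∃ σ, R = (μ σ).toAdd.1} := by
  obtain ⟨μ, hμ, hinj⟩ := h.exists_hom h2 h3
  refine ⟨μ, hμ, hinj, ?_⟩
  convert h.definableIn_shift h2 h3 h2K h3K hk hKF hLK hLc hF using 1
  ext R
  constructor
  · rintro ⟨σ, rfl⟩
    exact ⟨σ.1, σ.2, hμ σ⟩
  · rintro ⟨σ, hσ, P, Q, hP, hQ, rfl⟩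
    obtain ⟨P', Q', hP', hQ', e⟩ := hμ ⟨σ, hσ⟩
    exact ⟨⟨σ, hσ⟩, by rw [e, hP.eq hP', hQ.eq hQ']⟩

end WeierstrassExtension

end DiffSubfield

theorem lemma4p13 {A : Type*} [Field A] [CharZero A] [Differential A]
    (hclosed : IsDifferentiallyClosed A) (hsat : IsSaturated diffRingLanguage A)
    (K L U : DiffSubfield A) (hKA : #K < #A) (hLU : L ≤ U)
    (hL : IsStronglyNormal K L)
    (k g2 g3 : A) (hk : k ∈ K) (hk0 : k ≠ 0)
    (hg2 : g2 ∈ constants K) (hg3 : g3 ∈ constants K) (hΔ : g2 ^ 3 + 27 * g3 ^ 2 ≠ 0)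
    (a : L) (ha : L = gen ((K : Set A) ∪ {(a : A)}))
    (hW : (a : A)′ ^ 2 = k ^ 2 * (4 * (a : A) ^ 3 + g2 * (a : A) - g3)) :
    (∃ μ : gal K L →* Multiplicative (rationalPoints (constants K) hg2 hg3),
      (∀ σ, IsShift k a σ.1 (μ σ).toAdd.1) ∧
      Function.Injective μ ∧
      DefinableIn (constants K) Set.univ {R : Pt g2 g3 | ∃ σ, R = (μ σ).toAdd.1}) ∧
    (∃ μ : galOver U K L →* Multiplicative (rationalPoints (constants U)
          (constants_mono (hL.le.trans hLU) hg2) (constants_mono (hL.le.trans hLU) hg3)),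
      (∀ σ, IsShift k (⟨a, le_adjoinConstants L U a.2⟩ : adjoinConstants L U) σ.1
        (μ σ).toAdd.1) ∧
      Function.Injective μ ∧
      DefinableIn (constants U) {c | (c : A) ∈ K} {R : Pt g2 g3 | ∃ σ, R = (μ σ).toAdd.1}) := by
  have : IsAlgClosed A := hclosed.isAlgClosed
  have hy : ((a : A)′ / k) ^ 2 = 4 * (a : A) ^ 3 + g2 * (a : A) - g3 := by
    rw [div_pow, hW]
    field_simp
  have hay : (a : A)′ = k * ((a : A)′ / k) := by field_simp
  have hLc (x : A) (hx : x ∈ L) (h0 : x′ = 0) : x ∈ K :=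
    hL.mem_of_deriv_eq_zero hk hk0 hg2 hg3 hy hay ha hx h0
  refine ⟨?_, ?_⟩
  · have h : WeierstrassExtension K L (constants K) k g2 g3 a :=
      ⟨hL.le, fun _ => Iff.rfl, fun x hx h0 => ⟨hLc x hx h0, h0⟩, hk, hk0, hΔ, ha, hy⟩
    have hB : (Set.univ : Set (constants K)) =
        {c : constants K | (c : A) ∈ K} :=
      (Set.eq_univ_of_forall fun c : constants K => c.2.1).symm
    rw [hB]
    exact h.exists_hom_definableIn hg2 hg3 hg2.1 hg3.1 hk le_rfl ha hLc
      fun x hx => IntermediateField.algebraMap_mem _ (⟨x, hx⟩ : K)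
  -- Since ⟨L, C_U⟩ ⊆ U, its constants are those of U; the base field is ⟨K, C_U⟩, which equals
  -- K(C_U) because constants add no derivatives.
  · have hMU : adjoinConstants L U ≤ U := gen_le (Set.union_subset hLU fun x hx => hx.1)
    have hFM : adjoinConstants K U ≤ adjoinConstants L U := gen_le (Set.union_subset
      (hL.le.trans (le_adjoinConstants L U)) fun x hx => subset_gen _ (Or.inr hx))
    have hF (x : A) (hx : x ∈ adjoinConstants K U) :
        x ∈ IntermediateField.adjoin K (constants U : Set A) := by
      rw [mem_adjoin_iff_mem_closure]
      refine (mem_gen_iff_mem_closure ?_).1 hx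
      rintro s (hs | hs)
      · exact Subfield.subset_closure (Or.inl (K.deriv_mem hs))
      · rw [hs.2]
        exact zero_mem _
    have hgen : adjoinConstants L U = gen ((adjoinConstants K U : Set A) ∪ {(a : A)}) := by
      refine le_antisymm (gen_le (Set.union_subset ?_ ?_)) (gen_le (Set.union_subset hFM ?_))
      · have hle : L ≤ gen ((adjoinConstants K U : Set A) ∪ {(a : A)}) := by
          refine ha.le.trans (gen_le (Set.union_subset ?_ ?_))
          · exact fun x hx => subset_gen _ (Or.inl (le_adjoinConstants K U hx))
          · exact fun x hx => subset_gen _ (Or.inr hx)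
        exact hle
      · exact fun x hx => subset_gen _ (Or.inl (subset_gen _ (Or.inr hx)))
      · rintro _ rfl
        exact le_adjoinConstants L U a.2
    have h : WeierstrassExtension (adjoinConstants K U) (adjoinConstants L U) (constants U) k g2 g3
        ⟨a, le_adjoinConstants L U a.2⟩ :=
      ⟨hFM, fun x => ⟨fun hx => ⟨subset_gen _ (Or.inr hx), hx.2⟩,
        fun hx => ⟨hMU (hFM hx.1), hx.2⟩⟩, fun x hx h0 => ⟨hMU hx, h0⟩,
        le_adjoinConstants K U hk, hk0, hΔ, hgen, hy⟩
    exact h.exists_hom_definableIn _ _ hg2.1 hg3.1 hk (le_adjoinConstants K U) ha hLc hF
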